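/- For a finite group $X$ let $\mathrm m(X)$ be the number of maximal subgroups of $X$, let $\Phi(X)$ be its Frattini subgroup and, if $X$ is not cyclic, let $\sigma(X)$ be the least positive integer $n$ such that $X$ is the union of $n$ proper subgroups. Write $\mathbb Z_n$ for the cyclic group of order $n$. **Corollary 3.4.** Let $G$ be a finite non-nilpotent soluble group, put $\sigma=\sigma(G)$, and suppose that $\mathrm m(G)<2\sigma-1$. Then $\sigma\neq 3$, the number $\sigma-1$ is a power of a prime with positive exponent, and, writing $E_{\sigma-1}$ for the elementary abelian group of order $\sigma-1$, there exist a positive integer $t$ dividing $|\mathrm{Aut}(E_{\sigma-1})|$, a semidirect product $E_{\sigma-1}\rtimes\mathbb Z_t$ (for some action of $\mathbb Z_t$ on $E_{\sigma-1}$ by automorphisms), an integer $\ell\ge 0$ and distinct primes $p_1,\dots,p_\ell$ coprime to $t$ such that $$\ell=\mathrm m(G)-\mathrm m(\mathbb Z_t)-\sigma+1$$ and $$G/\Phi(G)\;\cong\;(E_{\sigma-1}\rtimes\mathbb Z_t)\times\mathbb Z_{p_1\cdots p_\ell},$$ where the empty product (for $\ell=0$) is $1$. -/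

import Mathlib

/-- `m(G)`: the number of maximal subgroups of `G`. -/
noncomputable def numMaximalSubgroups (G : Type*) [Group G] : ℕ :=
  Nat.card {M : Subgroup G // IsCoatom M}

/-- `G` is the union of (at most) `n` proper subgroups `H 0, …, H (n - 1)`. -/
def IsUnionOfProperSubgroups (G : Type*) [Group G] (n : ℕ) : Prop :=
  ∃ H : Fin n → Subgroup G, (∀ i, H i ≠ ⊤) ∧ (⋃ i, (H i : Set G)) = Set.univ

/-- `σ(G)`: the least `n` such that `G` is the union of `n` proper subgroups.
For a finite group such an `n` exists exactly when `G` is not cyclic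
(for a cyclic group the value is the default `0`). -/
noncomputable def coveringNumber (G : Type*) [Group G] : ℕ :=
  sInf {n : ℕ | IsUnionOfProperSubgroups G n}

/-- The value of `coveringNumber` is attained for every finite non-cyclic group. -/
theorem coveringNumber_isLeast (G : Type*) [Group G] [Finite G] (hG : ¬ IsCyclic G) :
    IsLeast {n : ℕ | IsUnionOfProperSubgroups G n} (coveringNumber G) := by
  have hne : {n : ℕ | IsUnionOfProperSubgroups G n}.Nonempty := by
    refine ⟨Nat.card G, fun i => Subgroup.zpowers ((Finite.equivFin G).symm i), ?_, ?_⟩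
    · intro i h
      exact hG ⟨(Finite.equivFin G).symm i, fun x => (Subgroup.eq_top_iff' _).mp h x⟩
    · ext g
      simp only [Set.mem_iUnion, SetLike.mem_coe, Set.mem_univ, iff_true]
      exact ⟨Finite.equivFin G g, by simp⟩
  exact ⟨Nat.sInf_mem hne, fun _ h => Nat.sInf_le h⟩

/-- The cyclic group `ℤ_n` of order `n` (for `n ≠ 0`), written multiplicatively. -/
abbrev CyclicGroupZ (n : ℕ) : Type := Multiplicative (ZMod n)

/-- The elementary abelian group of order `q ^ k` (`q` a prime), written multiplicatively. -/
abbrev ElementaryAbelian (q k : ℕ) : Type := Multiplicative (Fin k → ZMod q)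

/-! Everything rests on the bound σ ≤ |G : L| + 1 for each non-normal maximal subgroup L of a finite
soluble group. Such an L exists because G is not nilpotent, and it has |G : L| ≥ σ - 1 conjugates.
Two classes of such subgroups, together with one normal maximal subgroup, would give m(G) ≥ 2σ - 1.
So would a non-cyclic G/G', since then the normal maximal subgroups alone cover G and number at
least σ. Hence G/G' is cyclic and the non-normal maximal subgroups form one class.

Modulo Φ(G) this fixes the structure. A normal subgroup outside L contains G', and G' meets the core
of L in Φ = 1. So G' is minimal normal, hence elementary abelian, with cyclic complement L. The core
of L is central, of squarefree order prime to that of its complement T in L, and T acts faithfully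
on G'. A cover needs a different member for each element of G'x, where x generates G modulo G', and
one more for G' itself; so σ = |G : L| + 1 = |G'| + 1, and m(G) = m(L) + |G : L| yields ℓ.

For the bound, take L of least index and factor out its core. The quotient Q has a self-centralizing
minimal normal subgroup B with |B| = |Q : L|, on which Q/B acts faithfully and irreducibly. If Q/B
is cyclic, B and the conjugates of L cover Q. If it is nilpotent but not cyclic, a non-cyclic Sylow
factor is covered by p + 1 ≤ |B| proper subgroups. Otherwise `exists_nonnormal_isCoatom_index_lt`
gives a non-normal maximal subgroup of index below |B|, against the choice of L. Its core is
`relIndex_le_card_of_normal_pgroup`: if the bound |P : P ∩ S| ≤ |V| failed, P would be its only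
J-normal subgroup of index at most |V|. Permuting weights then forces P to have class at most two,
counting modulo the centre makes P abelian, and an abelian P has order at most |V|. -/

/-! ### Counting bounds for completely reducible linear groups -/

/-- Index bounds for a subadditive family of subgroups propagate from the simple submodules of a
finite semisimple module to all submodules. -/
theorem index_le_card_of_forall_simple {R M P : Type*} [Ring R] [AddCommGroup M] [Module R M]
    [IsSemisimpleModule R M] [Finite M] [Group P] (C : Submodule R M → Subgroup P)
    (hsup : ∀ W₁ W₂, C W₁ ⊓ C W₂ ≤ C (W₁ ⊔ W₂)) (hbot : C ⊥ = ⊤)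
    (hfin : ∀ W, (C W).index ≠ 0)
    (hs : ∀ W : Submodule R M, IsSimpleModule R W → (C W).index ≤ Nat.card W)
    (W : Submodule R M) : (C W).index ≤ Nat.card W := by
  induction W using WellFoundedLT.induction with
  | ind W ih =>
    rcases eq_or_ne W ⊥ with rfl | hW
    · simp [hbot]
    -- Split off a simple S with complement T: W is the direct sum of S and W ⊓ T, so orders
    -- multiply while indices are submultiplicative.
    · obtain ⟨S, hS, hSW⟩ := (eq_bot_or_exists_atom_le W).resolve_left hW
      obtain ⟨T, hT⟩ := exists_isCompl S
      have hTW : W ⊓ T < W := by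
        refine lt_of_le_of_ne inf_le_left fun h => hS.1 ?_
        have h1 : S ≤ T := hSW.trans (inf_eq_left.mp h)
        exact disjoint_self.mp (hT.disjoint.mono_right h1)
      have hsupW : S ⊔ W ⊓ T = W := by
        rw [inf_comm, ← sup_inf_assoc_of_le T hSW, hT.sup_eq_top, top_inf_eq]
      have h1 : (C W).index ≤ (C S).index * (C (W ⊓ T)).index := by
        calc (C W).index = (C (S ⊔ W ⊓ T)).index := by rw [hsupW]
          _ ≤ (C S ⊓ C (W ⊓ T)).index := by
            refine Nat.le_of_dvd (Nat.pos_of_ne_zero ?_) (Subgroup.index_dvd_of_le (hsup _ _))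
            exact Subgroup.index_inf_ne_zero (hfin _) (hfin _)
          _ ≤ _ := Subgroup.index_inf_le
      have h2 : Nat.card S * Nat.card (W ⊓ T : Submodule R M) ≤ Nat.card W := by
        rw [← Nat.card_prod]
        refine Nat.card_le_card_of_injective
          (fun x : S × (W ⊓ T : Submodule R M) =>
            (⟨x.1.1 + x.2.1, W.add_mem (hSW x.1.2) x.2.2.1⟩ : W)) ?_
        rintro ⟨⟨a, ha⟩, ⟨b, hb⟩⟩ ⟨⟨c, hc⟩, ⟨d, hd⟩⟩ h
        have h' : a + b = c + d := congrArg Subtype.val h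
        have h3 : a - c = d - b := by rw [sub_eq_sub_iff_add_eq_add, h']; exact add_comm _ _
        have h4 : a - c = 0 := by
          have : a - c ∈ S ⊓ T := ⟨S.sub_mem ha hc, h3 ▸ T.sub_mem hd.2 hb.2⟩
          rwa [hT.inf_eq_bot] at this
        have h5 : d - b = 0 := h3 ▸ h4
        simp only [Prod.mk.injEq, Subtype.mk.injEq]
        exact ⟨sub_eq_zero.mp h4, (sub_eq_zero.mp h5).symm⟩
      exact h1.trans ((Nat.mul_le_mul (hs S (isSimpleModule_iff_isAtom.mpr hS))
        (ih _ hTW)).trans h2)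

open MonoidAlgebra in
theorem of_mul_comm_of_central {k P : Type*} [Field k] [Group P] {z : P}
    (hz : ∀ g, z * g = g * z) (r : MonoidAlgebra k P) : of k P z * r = r * of k P z := by
  induction r using MonoidAlgebra.induction_on with
  | of g => rw [← map_mul, ← map_mul, hz]
  | add f g hf hg => rw [mul_add, add_mul, hf, hg]
  | smul c f hf => rw [mul_smul_comm, smul_mul_assoc, hf]

open MonoidAlgebra in
/-- An abelian group acting faithfully and completely reducibly has order at most the size of the
module. -/
theorem card_le_card_of_comm_of_semisimple {k P V : Type*} [Field k] [Group P] [Finite P]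
    [AddCommGroup V] [Module (MonoidAlgebra k P) V] [IsSemisimpleModule (MonoidAlgebra k P) V]
    [Finite V] (hP : ∀ x y : P, x * y = y * x)
    (hf : ∀ x : P, (∀ v : V, of k P x • v = v) → x = 1) : Nat.card P ≤ Nat.card V := by
  classical
  let C : Submodule (MonoidAlgebra k P) V → Subgroup P := fun W =>
    { carrier := {x | ∀ w ∈ W, of k P x • w = w}
      one_mem' := by
        intro w _
        rw [map_one, one_smul]
      mul_mem' := by
        intro a b ha hb w hw
        rw [map_mul, mul_smul, hb w hw, ha w hw]
      inv_mem' := by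
        intro a ha w hw
        nth_rewrite 1 [← ha w hw]
        rw [← mul_smul, ← map_mul, inv_mul_cancel, map_one, one_smul] }
  have hC : ∀ W x, x ∈ C W ↔ ∀ w ∈ W, of k P x • w = w := fun W x => Iff.rfl
  have key := index_le_card_of_forall_simple C ?_ ?_ (fun W => Subgroup.index_ne_zero_of_finite) ?_ ⊤
  · have : C ⊤ = ⊥ := by
      rw [eq_bot_iff]
      intro x hx
      exact hf x fun v => hx v trivial
    rw [this, Subgroup.index_bot] at key
    simpa using key
  · intro W₁ W₂ x hx w hw
    obtain ⟨a, ha, b, hb, rfl⟩ := Submodule.mem_sup.mp hw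
    rw [smul_add, hx.1 a ha, hx.2 b hb]
  · ext x; simp [hC]
  · intro W hW
    have := IsSimpleModule.nontrivial (MonoidAlgebra k P) W
    obtain ⟨w, hw⟩ := exists_ne (0 : W)
    -- A nonzero w generates the simple module W, and x commutes with the whole group algebra, so
    -- fixing w means fixing W. Cosets of C W therefore move w to different vectors.
    have hst : ∀ x, of k P x • w = w → x ∈ C W := by
      intro x hx u hu
      have := IsSimpleModule.toSpanSingleton_surjective (MonoidAlgebra k P) hw ⟨u, hu⟩
      obtain ⟨r, hr⟩ := this
      have hr' : r • (w : V) = u := congrArg Subtype.val hr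
      have hx' : of k P x • (w : V) = w := congrArg Subtype.val hx
      rw [← hr', ← mul_smul]
      have hcomm : of k P x * r = r * of k P x := of_mul_comm_of_central (hP x) r
      rw [hcomm, mul_smul, hx']
    rw [Subgroup.index]
    refine Nat.card_le_card_of_injective (fun q : P ⧸ C W => of k P q.out • w) ?_
    intro a b hab
    rw [← a.out_eq, ← b.out_eq]
    refine QuotientGroup.eq.mpr (hst _ ?_)
    have hab' : of k P a.out • w = of k P b.out • w := hab
    rw [map_mul, mul_smul, ← hab', ← mul_smul, ← map_mul, inv_mul_cancel, map_one, one_smul]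

/-- Joint eigenvectors with pairwise distinct systems of eigenvalues are linearly independent. -/
theorem linearIndependent_of_joint_eigenvectors {D E Γ ι : Type*} [Field D] [AddCommGroup E]
    [Module D E] (T : Γ → E →ₗ[D] E) (v : ι → E) (hv : ∀ i, v i ≠ 0) (c : ι → Γ → D)
    (hc : Function.Injective c) (hT : ∀ i g, T g (v i) = c i g • v i) :
    LinearIndependent D v := by
  classical
  rw [linearIndependent_iff']
  intro s
  induction s using Finset.induction_on with
  | empty => simp
  | insert j s hj ih =>
    intro a ha
    rw [Finset.sum_insert hj] at ha
    have hs : ∀ i ∈ s, a i = 0 := by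
      intro i hi
      have hij : c i ≠ c j := fun h => hj (hc h ▸ hi)
      obtain ⟨g, hg⟩ := Function.ne_iff.mp hij
      have h1 := congrArg (T g) ha
      have h2 := congrArg (c j g • ·) ha
      simp only [map_add, map_sum, map_smul, hT, map_zero, smul_add, smul_zero, Finset.smul_sum]
        at h1 h2
      rw [smul_comm (a j)] at h1
      -- Applying T g - c j g to the relation kills the term of j and leaves a relation over s.
      have h3 := ih (fun i => a i * (c i g - c j g)) (by
        have h4 : ∑ i ∈ s, a i • c i g • v i - ∑ i ∈ s, c j g • a i • v i = 0 := by
          rw [← add_sub_add_left_eq_sub _ _ (c j g • a j • v j), h1, h2, sub_zero]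
        rw [← Finset.sum_sub_distrib] at h4
        rw [← h4]
        refine Finset.sum_congr rfl fun i _ => ?_
        rw [mul_sub, sub_smul, mul_smul, mul_comm, mul_smul]) i hi
      exact (mul_eq_zero.mp h3).resolve_right (sub_ne_zero.mpr hg)
    rw [Finset.sum_eq_zero fun i hi => by rw [hs i hi, zero_smul], add_zero] at ha
    intro i hi
    rcases Finset.mem_insert.mp hi with rfl | hi
    · exact (smul_eq_zero.mp ha).resolve_right (hv i)
    · exact hs i hi

/-- Compares dim End(W) with |W|. Base 2 fails at n = 3, which is why at least three scalars are
required later. -/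
theorem sq_le_three_pow (n : ℕ) : n * n ≤ 3 ^ n := by
  induction n with
  | zero => simp
  | succ n ih =>
    rcases Nat.lt_or_ge n 2 with h | h
    · interval_cases n <;> norm_num
    · rw [pow_succ]; nlinarith

/-- A family of automorphisms of a vector space over a field with at least three elements, which
commute with each other up to pairwise different systems of scalars, is smaller than the space. -/
theorem card_le_card_of_commute_up_to_scalar {D W Γ ι : Type*} [Field D] [Finite D]
    [AddCommGroup W] [Module D W] [Finite W] [Finite ι] (hD : 3 ≤ Nat.card D)
    (ρ : Γ → W ≃ₗ[D] W) (x : ι → W ≃ₗ[D] W) (c : ι → Γ → D)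
    (hc : Function.Injective c) (h : ∀ i g w, ρ g (x i w) = c i g • x i (ρ g w))
    (hW : Nontrivial W) :
    Nat.card ι ≤ Nat.card W := by
  classical
  cases nonempty_fintype ι
  cases nonempty_fintype D
  cases nonempty_fintype W
  have hli : LinearIndependent D (fun i => (x i : W →ₗ[D] W)) := by
    -- The operators are the conjugations f ↦ ρ(g) f ρ(g)⁻¹ of End_D W, and each x i is a joint
    -- eigenvector with eigenvalues c i.
    refine linearIndependent_of_joint_eigenvectors
      (fun g => (LinearMap.llcomp D W W W (ρ g : W →ₗ[D] W)) ∘ₗ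
        (LinearMap.lcomp D W ((ρ g).symm : W →ₗ[D] W))) _ ?_ c hc ?_
    · intro i h0
      obtain ⟨w, hw⟩ := exists_ne (0 : W)
      have : x i w = 0 := by simpa using congrArg (fun f : W →ₗ[D] W => f w) h0
      exact hw (by simpa using this)
    · intro i g
      ext w
      simp [h]
  have h1 := hli.fintype_card_le_finrank
  rw [Module.finrank_linearMap] at h1
  rw [Nat.card_eq_fintype_card] at hD ⊢
  rw [Nat.card_eq_fintype_card, Module.card_eq_pow_finrank (K := D) (V := W)]
  exact h1.trans ((sq_le_three_pow _).trans (Nat.pow_le_pow_left hD _))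

open MonoidAlgebra in
open scoped commutatorElement in
/-- If the commutator subgroup of `P` is central and `P` acts faithfully and completely reducibly
on `V` then `|P : Z(P)| ≤ |V|`. -/
theorem index_center_le_card_of_semisimple {k P V : Type*} [Field k] [Group P] [Finite P]
    [AddCommGroup V] [Module (MonoidAlgebra k P) V] [IsSemisimpleModule (MonoidAlgebra k P) V]
    [Finite V] (hP : commutator P ≤ Subgroup.center P)
    (hf : ∀ x : P, (∀ v : V, of k P x • v = v) → x = 1) :
    (Subgroup.center P).index ≤ Nat.card V := by
  classical
  -- C W collects the x whose commutators with P act trivially on W; by faithfulness C ⊤ is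
  -- contained in the centre.
  let C : Submodule (MonoidAlgebra k P) V → Subgroup P := fun W =>
    { carrier := {x | ∀ g, ∀ w ∈ W, of k P (x * g) • w = of k P (g * x) • w}
      one_mem' := by simp
      mul_mem' := by
        intro a b ha hb g w hw
        have h1 := hb g w hw
        have h2 := ha g _ (W.smul_mem (of k P b) hw)
        rw [mul_assoc, map_mul, mul_smul, h1, ← mul_smul, ← map_mul, ← mul_assoc, map_mul,
          mul_smul, h2, ← mul_smul, ← map_mul, mul_assoc]
      inv_mem' := by
        intro a ha g w hw
        have h1 := ha g _ (W.smul_mem (of k P a⁻¹) hw)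
        rw [← mul_smul, ← mul_smul, ← map_mul, ← map_mul] at h1
        have h2 := congrArg (of k P a⁻¹ • ·) h1
        simp only [← mul_smul, ← map_mul] at h2
        rw [← mul_assoc, ← mul_assoc, inv_mul_cancel, one_mul, mul_assoc g, mul_inv_cancel,
          mul_one] at h2
        exact h2.symm }
  have hC : ∀ W x, x ∈ C W ↔ ∀ g, ∀ w ∈ W, of k P (x * g) • w = of k P (g * x) • w :=
    fun W x => Iff.rfl
  have key := index_le_card_of_forall_simple C ?_ ?_ (fun W => Subgroup.index_ne_zero_of_finite) ?_ ⊤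
  · have : C ⊤ ≤ Subgroup.center P := by
      intro x hx
      rw [Subgroup.mem_center_iff]
      intro g
      rw [← inv_mul_eq_one]
      refine hf _ fun v => ?_
      rw [map_mul, mul_smul, hx g v trivial, ← mul_smul, ← map_mul, inv_mul_cancel, map_one,
        one_smul]
    refine (Nat.le_of_dvd (Nat.pos_of_ne_zero Subgroup.index_ne_zero_of_finite)
      (Subgroup.index_dvd_of_le this)).trans ?_
    simpa using key
  · intro W₁ W₂ x hx g w hw
    obtain ⟨a, ha, b, hb, rfl⟩ := Submodule.mem_sup.mp hw
    rw [smul_add, smul_add, hx.1 g a ha, hx.2 g b hb]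
  · ext x; simp [hC]
  · intro W hW
    rcases eq_or_ne (C W) ⊤ with hCW | hCW
    · rw [hCW, Subgroup.index_top]
      exact Nat.card_pos
    have hWn := IsSimpleModule.nontrivial (MonoidAlgebra k P) W
    -- By Schur and Wedderburn D is a finite field. Commutators are central in P, so they act on W
    -- as scalars from D.
    let D := Module.End (MonoidAlgebra k P) W
    let _ : DivisionRing D := Module.End.instDivisionRing
    have hDfin : Finite D := Finite.of_injective (fun f : D => (f : W → W)) DFunLike.coe_injective
    let _ : Field D := littleWedderburn D
    let _ : Module D W := Module.End.applyModule
    let act : P → W ≃ₗ[D] W := fun x =>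
      { toFun := fun w => of k P x • w
        map_add' := fun a b => smul_add _ _ _
        map_smul' := fun d w => (d.map_smul (of k P x) w).symm
        invFun := fun w => of k P x⁻¹ • w
        left_inv := fun w => by
          simp only []
          rw [← mul_smul, ← map_mul, inv_mul_cancel, map_one, one_smul]
        right_inv := fun w => by
          simp only []
          rw [← mul_smul, ← map_mul, mul_inv_cancel, map_one, one_smul] }
    have hact : ∀ x w, act x w = of k P x • w := fun _ _ => rfl
    have hcent : ∀ g x : P, ∀ h, g⁻¹ * x⁻¹ * g * x * h = h * (g⁻¹ * x⁻¹ * g * x) := by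
      intro g x h
      have h1 : ⁅g⁻¹, x⁻¹⁆ ∈ Subgroup.center P :=
        hP (Subgroup.commutator_mem_commutator (Subgroup.mem_top _) (Subgroup.mem_top _))
      have h2 := Subgroup.mem_center_iff.mp h1 h
      simpa [commutatorElement_def] using h2.symm
    let sc : P → P → D := fun x g =>
      { toFun := fun w => of k P (g⁻¹ * x⁻¹ * g * x) • w
        map_add' := fun a b => smul_add _ _ _
        map_smul' := fun r w => by
          rw [RingHom.id_apply, ← mul_smul, of_mul_comm_of_central (hcent g x), mul_smul] }
    have hsc : ∀ (x g : P) (w : W), sc x g • w = of k P (g⁻¹ * x⁻¹ * g * x) • w := fun _ _ _ => rfl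
    -- Since C W is proper, some commutator acts as a scalar other than 0 and 1.
    have hD : 3 ≤ Nat.card D := by
      cases nonempty_fintype D
      rw [Nat.card_eq_fintype_card]
      obtain ⟨x, hx⟩ : ∃ x, x ∉ C W := by
        by_contra! h
        exact hCW (eq_top_iff.mpr fun x _ => h x)
      rw [hC] at hx
      push Not at hx
      obtain ⟨g, w, hw, hne⟩ := hx
      refine Fintype.two_lt_card_iff.mpr ⟨0, 1, sc x g, zero_ne_one, ?_, ?_⟩
      · intro h
        have h1 := hsc x g ⟨w, hw⟩
        rw [← h, zero_smul] at h1
        have h2 : act (g⁻¹ * x⁻¹ * g * x) ⟨w, hw⟩ = 0 := h1.symm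
        have h3 := (LinearEquiv.map_eq_zero_iff _).mp h2
        have h4 : w = 0 := congrArg Subtype.val h3
        exact hne (by rw [h4, smul_zero, smul_zero])
      · intro h
        have h1 := hsc x g ⟨w, hw⟩
        rw [← h, one_smul] at h1
        have h2 : w = of k P (g⁻¹ * x⁻¹ * g * x) • w := congrArg Subtype.val h1
        apply hne
        nth_rewrite 1 [h2]
        rw [← mul_smul, ← map_mul]
        congr 2
        group
    rw [Subgroup.index]
    refine card_le_card_of_commute_up_to_scalar hD act (fun q : P ⧸ C W => act q.out)
      (fun q g => sc q.out g) ?_ ?_ hWn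
    · intro a b hab
      rw [← a.out_eq, ← b.out_eq]
      refine QuotientGroup.eq.mpr ?_
      intro h w hw
      generalize hx : b.out = x
      generalize hy : a.out = y
      -- Evaluated at the conjugate of h by x and applied to y⁻¹xw, the two equal scalars reduce to
      -- the identity saying that y⁻¹x and h commute on W.
      have h1 := congrFun hab (x * h * x⁻¹)
      simp only [hx, hy] at h1
      have h2 := congrArg (· • act (y⁻¹ * x) ⟨w, hw⟩) h1
      simp only [hsc] at h2
      have h3 := congrArg (act (x * h * x⁻¹)) h2
      simp only [hact, ← mul_smul, ← map_mul] at h3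
      have h4 := congrArg Subtype.val h3
      simp only [Submodule.coe_smul] at h4
      have e1 : x * h * x⁻¹ * ((x * h * x⁻¹)⁻¹ * y⁻¹ * (x * h * x⁻¹) * y * (y⁻¹ * x))
          = y⁻¹ * x * h := by group
      have e2 : x * h * x⁻¹ * ((x * h * x⁻¹)⁻¹ * x⁻¹ * (x * h * x⁻¹) * x * (y⁻¹ * x))
          = h * (y⁻¹ * x) := by group
      rw [e1, e2] at h4
      exact h4
    · intro q g w
      simp only [hact, hsc]
      rw [← mul_smul, ← map_mul, ← mul_smul, ← map_mul, ← mul_smul, ← map_mul, mul_assoc,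
        hcent]
      congr 2
      group

/-! ### Permutation of weights by a linear group -/

open Module.End Polynomial in
/-- A finite group permutes the weights of an abelian normal subgroup `A` in a faithful
non-modular representation over an algebraically closed field; the elements fixing all the weights
centralize `A`. -/
theorem exists_perm_hom_of_isAlgClosed {K J V : Type*} [Field K] [IsAlgClosed K] [Group J]
    [AddCommGroup V] [Module K V] [FiniteDimensional K V] (ρ : J →* Module.End K V)
    (hρ : Function.Injective ρ) (A : Subgroup J) [A.Normal] [Finite A]
    (hA : ∀ a ∈ A, ∀ b ∈ A, a * b = b * a) (hK : (Nat.card A : K) ≠ 0) :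
    ∃ t ≤ Module.finrank K V, ∃ f : J →* Equiv.Perm (Fin t), ∀ x ∈ f.ker, ∀ a ∈ A,
      x * a = a * x := by
  classical
  have hss : ∀ a : A, (ρ a).IsFinitelySemisimple := by
    intro a
    refine IsSemisimple.isFinitelySemisimple ?_
    -- As |A| is nonzero in K, the polynomial X^|A| - 1 is separable, so each element of A acts
    -- diagonalizably.
    refine isSemisimple_of_squarefree_aeval_eq_zero (p := X ^ Nat.card A - 1)
      (X_pow_sub_one_separable_iff.mpr hK).squarefree ?_
    rw [map_sub, map_pow, aeval_X, map_one, ← map_pow, ← Subgroup.coe_pow, pow_card_eq_one',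
      Subgroup.coe_one, map_one, sub_self]
  -- Weight spaces of A. By semisimplicity the generalized eigenspaces are eigenspaces; the nonzero
  -- E χ are independent, so there are at most dim V of them.
  let E : (A → K) → Submodule K V := fun χ => ⨅ a : A, (ρ a).maxGenEigenspace (χ a)
  have hE : ∀ χ v, v ∈ E χ ↔ ∀ a : A, ρ a v = χ a • v := by
    intro χ v
    simp only [E, Submodule.mem_iInf, (hss _).maxGenEigenspace_eq_eigenspace, mem_eigenspace_iff]
  have hcomm : ∀ a b : A, Commute (ρ a) (ρ b) := by
    intro a b
    rw [Commute, SemiconjBy, ← map_mul, ← map_mul, hA a a.2 b b.2]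
  have hind : iSupIndep E :=
    independent_iInf_maxGenEigenspace_of_forall_mapsTo (fun a : A => ρ a) fun a b φ =>
      mapsTo_maxGenEigenspace_of_comm (hcomm b a) φ
  have htop : ⨆ χ, E χ = ⊤ :=
    iSup_iInf_maxGenEigenspace_eq_top_of_iSup_maxGenEigenspace_eq_top_of_commute
      (fun a : A => ρ a) (fun a b _ => hcomm a b) fun a => iSup_maxGenEigenspace_eq_top _
  let _ : Fintype {χ // E χ ≠ ⊥} := hind.fintypeNeBotOfFiniteDimensional
  have hcard := hind.subtype_ne_bot_le_finrank
  have hmove : ∀ x χ v, v ∈ E χ → ρ x v ∈ E (fun a => χ (MulAut.conjNormal x⁻¹ a)) := by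
    intro x χ v hv
    rw [hE] at hv ⊢
    intro a
    rw [← map_smul, ← hv, ← Module.End.mul_apply, ← Module.End.mul_apply, ← map_mul, ← map_mul,
      MulAut.conjNormal_apply]
    congr 2
    group
  let g : J →* Function.End {χ // E χ ≠ ⊥} :=
    { toFun := fun x χ => ⟨fun a => χ.1 (MulAut.conjNormal x⁻¹ a), by
        obtain ⟨v, hv, hv0⟩ := Submodule.exists_mem_ne_zero_of_ne_bot χ.2
        refine (Submodule.ne_bot_iff _).mpr ⟨ρ x v, hmove x _ v hv, fun h => hv0 ?_⟩
        have : ρ x⁻¹ (ρ x v) = v := by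
          rw [← Module.End.mul_apply, ← map_mul, inv_mul_cancel, map_one, Module.End.one_apply]
        rw [← this, h, map_zero]⟩
      map_one' := by
        refine funext fun χ => Subtype.ext (funext fun a => ?_)
        simp only [inv_one, map_one]
        rfl
      map_mul' := by
        intro x y
        refine funext fun χ => Subtype.ext (funext fun a => ?_)
        simp only [mul_inv_rev, map_mul]
        rfl }
  let e := Fintype.equivFin {χ // E χ ≠ ⊥}
  refine ⟨_, hcard, e.permCongrHom.toMonoidHom.comp g.toHomPerm, fun x hx a ha => ?_⟩
  have hx' : g.toHomPerm x = 1 := by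
    rw [MonoidHom.mem_ker] at hx
    exact (MulEquiv.map_eq_one_iff e.permCongrHom).mp hx
  have hx'' : ∀ χ, E χ ≠ ⊥ → ∀ a, χ (MulAut.conjNormal x⁻¹ a) = χ a := by
    intro χ hχ a
    have := congrArg (fun q : Equiv.Perm {χ // E χ ≠ ⊥} => (q ⟨χ, hχ⟩).1 a) hx'
    exact this
  have h1 : ρ (x⁻¹ * a * x) = ρ a := by
    ext v
    have hv : v ∈ ⨆ χ, E χ := htop ▸ trivial
    induction hv using Submodule.iSup_induction' with
    | mem χ v hv =>
      rcases eq_or_ne (E χ) ⊥ with h | h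
      · rw [h, Submodule.mem_bot] at hv
        rw [hv, map_zero, map_zero]
      · rw [hE] at hv
        have h2 := hv (MulAut.conjNormal x⁻¹ ⟨a, ha⟩)
        rw [hx'' χ h, ← hv, MulAut.conjNormal_apply, inv_inv] at h2
        exact h2
    | zero => rw [map_zero, map_zero]
    | add u v _ _ hu hv => rw [map_add, map_add, hu, hv]
  have h2 := hρ h1
  calc x * a = x * (x⁻¹ * a * x) := by rw [h2]
    _ = a * x := by group

/-- A finite group permutes at most `dim V` weights of an abelian normal subgroup `A` in a faithful
non-modular representation `V`; the elements fixing all the weights centralize `A`. -/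
theorem exists_perm_hom {k J V : Type*} [Field k] [Group J]
    [AddCommGroup V] [Module k V] [FiniteDimensional k V] (ρ : J →* Module.End k V)
    (hρ : Function.Injective ρ) (A : Subgroup J) [A.Normal] [Finite A]
    (hA : ∀ a ∈ A, ∀ b ∈ A, a * b = b * a) (hK : (Nat.card A : k) ≠ 0) :
    ∃ t ≤ Module.finrank k V, ∃ f : J →* Equiv.Perm (Fin t), ∀ x ∈ f.ker, ∀ a ∈ A,
      x * a = a * x := by
  have h := exists_perm_hom_of_isAlgClosed (K := AlgebraicClosure k)
    (V := TensorProduct k (AlgebraicClosure k) V)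
    ((Module.End.baseChangeHom k (AlgebraicClosure k) V).toRingHom.toMonoidHom.comp ρ) ?_ A hA ?_
  · rwa [Module.finrank_baseChange] at h
  · exact (LinearMap.baseChangeHom_injective k V (AlgebraicClosure k)).comp hρ
  · intro h0
    apply hK
    apply (algebraMap k (AlgebraicClosure k)).injective
    rw [map_natCast, h0, map_zero]

/-- A `p`-group of permutations of `t` points has order at most `2 ^ t`. -/
theorem card_le_two_pow_of_perm {p t : ℕ} [Fact p.Prime] {H : Type*} [Group H]
    (hH : IsPGroup p H) (f : H →* Equiv.Perm (Fin t)) (hf : Function.Injective f) :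
    Nat.card H ≤ 2 ^ t := by
  have hfin : Finite H := Finite.of_injective f hf
  obtain ⟨n, hn⟩ := IsPGroup.iff_card.mp hH
  have h1 : Nat.card H ∣ t.factorial := by
    have := Subgroup.card_dvd_of_injective f hf
    rwa [Nat.card_perm, Nat.card_fin] at this
  rw [hn] at h1 ⊢
  have h2 : n ≤ padicValNat p t.factorial :=
    (padicValNat_dvd_iff_le t.factorial_ne_zero).mp h1
  -- Legendre's formula: (p - 1) v_p(t!) is t minus a digit sum, hence at most t.
  have h3 := sub_one_mul_padicValNat_factorial (p := p) t
  have h4 : (p - 1) * n ≤ t := (Nat.mul_le_mul_left _ h2).trans (h3 ▸ Nat.sub_le _ _)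
  have h5 : p ≤ 2 ^ (p - 1) := by
    have := Nat.lt_two_pow_self (n := p - 1)
    omega
  calc p ^ n ≤ (2 ^ (p - 1)) ^ n := Nat.pow_le_pow_left h5 n
    _ = 2 ^ ((p - 1) * n) := (pow_mul _ _ _).symm
    _ ≤ 2 ^ t := Nat.pow_le_pow_right (by norm_num) h4

/-! ### Normal `p`-subgroups of linear groups -/

open scoped commutatorElement in
/-- If every abelian subgroup of the nilpotent normal subgroup `P` that is normal in `J` is
centralized by `P`, then `P` has class at most two. -/
theorem commutator_le_centralizer_of_abelian_central {J : Type*} [Group J] (P : Subgroup J)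
    [P.Normal] [hnil : Group.IsNilpotent P]
    (h : ∀ A : Subgroup J, A ≤ P → A.Normal → ⁅A, A⁆ = ⊥ → ⁅A, P⁆ = ⊥) :
    ⁅⁅P, P⁆, P⁆ = ⊥ := by
  obtain ⟨n, hn⟩ := (Subgroup.isNilpotent_iff_lowerCentralSeries P).mp hnil
  have hle : ∀ n, P.lowerCentralSeries n ≤ P := Subgroup.lowerCentralSeries_le_self P
  have hnorm : ∀ n, (P.lowerCentralSeries n).Normal := by
    intro n
    induction n with
    | zero => simpa
    | succ d _ => rw [Subgroup.lowerCentralSeries_succ]; infer_instance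
  -- By the three subgroups lemma term m + 1 commutes with the commutator subgroup of P, which
  -- contains it; it is therefore abelian and `h` applies. This walks the series down to index 1.
  have hmain : ∀ m, ⁅P.lowerCentralSeries (m + 2), P⁆ = ⊥ →
      ⁅P.lowerCentralSeries (m + 1), P⁆ = ⊥ := by
    intro m hm
    refine h _ (hle _) (hnorm _) ?_
    have h1 : ⁅⁅P, P⁆, P.lowerCentralSeries (m + 1)⁆ = ⊥ := by
      refine Subgroup.commutator_commutator_eq_bot_of_rotate ?_ hm
      rw [Subgroup.commutator_comm P]
      exact hm
    have h2 : P.lowerCentralSeries (m + 1) ≤ ⁅P, P⁆ :=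
      Subgroup.lowerCentralSeries_antitone P (show 1 ≤ m + 1 by omega)
    exact le_bot_iff.mp (h1 ▸ Subgroup.commutator_mono h2 le_rfl)
  have hdown : ∀ j, ⁅P.lowerCentralSeries (j + 1), P⁆ = ⊥ → ⁅P.lowerCentralSeries 1, P⁆ = ⊥ := by
    intro j
    induction j with
    | zero => exact id
    | succ j ih => exact fun hj => ih (hmain j hj)
  refine hdown n ?_
  have h3 : P.lowerCentralSeries (n + 1) ≤ ⊥ :=
    hn ▸ Subgroup.lowerCentralSeries_antitone P (Nat.le_succ n)
  rw [le_bot_iff.mp h3, Subgroup.commutator_bot_left]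

open scoped commutatorElement in
/-- Let `J` act faithfully on a finite vector space `V` and let `P` be a normal `p`-subgroup of `J`,
where `p` is not the characteristic. If all normal subgroups of `J` properly contained in `P` lie
in `S`, then `|P : S| ≤ |V|`. -/
theorem relIndex_le_card_of_normal_pgroup {k J V : Type*} [Field k] [Finite k] [Group J] [Finite J]
    [AddCommGroup V] [Module k V] [FiniteDimensional k V] [Finite V] (ρ : J →* Module.End k V)
    (hρ : Function.Injective ρ) {p : ℕ} [hp : Fact p.Prime] (hpk : (p : k) ≠ 0)
    (P S : Subgroup J) [P.Normal] (hP : IsPGroup p P)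
    (hS : ∀ Y : Subgroup J, Y.Normal → Y < P → Y ≤ S) : S.relIndex P ≤ Nat.card V := by
  classical
  by_contra hcon
  -- A proper such Y would lie in S, and then |P : P ∩ S| would be at most |P : Y|.
  have hcon' : ∀ Y : Subgroup J, Y.Normal → Y ≤ P → Y.relIndex P ≤ Nat.card V → Y = P := by
    intro Y hY hYP hb
    by_contra hne
    refine hcon (le_trans (Nat.le_of_dvd ?_ (Subgroup.relIndex_dvd_of_le_left P
      (hS Y hY (lt_of_le_of_ne hYP hne)))) hb)
    exact Nat.pos_of_ne_zero Subgroup.index_ne_zero_of_finite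
  have hab : ∀ A : Subgroup J, A ≤ P → A.Normal → ⁅A, A⁆ = ⊥ → ⁅A, P⁆ = ⊥ := by
    intro A hAP hAn hA
    have hAk : (Nat.card A : k) ≠ 0 := by
      obtain ⟨n, hn⟩ := IsPGroup.iff_card.mp (hP.to_le hAP)
      rw [hn, Nat.cast_pow]
      exact pow_ne_zero _ hpk
    have hA' : ∀ a ∈ A, ∀ b ∈ A, a * b = b * a := fun a ha b hb =>
      (Subgroup.mem_centralizer_iff.mp
        (Subgroup.commutator_eq_bot_iff_le_centralizer.mp hA ha) b hb).symm
    obtain ⟨t, ht, f, hf⟩ := exists_perm_hom ρ hρ A hA' hAk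
    have hT := hcon' (f.ker ⊓ P) inferInstance inf_le_right ?_
    · rw [Subgroup.commutator_eq_bot_iff_le_centralizer]
      intro a ha
      rw [Subgroup.mem_centralizer_iff]
      intro x hx
      exact hf x (inf_eq_right.mp hT hx) a ha
    -- The image of P in the symmetric group on t ≤ dim V weights has order at most 2^t ≤ |k|^(dim
    -- V) = |V|.
    · rw [Subgroup.inf_relIndex_right, Subgroup.relIndex_ker]
      have h1 := card_le_two_pow_of_perm (hP.map f) (P.map f).subtype (P.map f).subtype_injective
      refine h1.trans ?_
      cases nonempty_fintype V
      cases nonempty_fintype k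
      rw [Nat.card_eq_fintype_card, Module.card_eq_pow_finrank (K := k) (V := V)]
      exact (Nat.pow_le_pow_right two_pos ht).trans
        (Nat.pow_le_pow_left Fintype.one_lt_card _)
  have hnil : Group.IsNilpotent P := hP.isNilpotent
  have hcl := commutator_le_centralizer_of_abelian_central P hab
  have hPk : NeZero (Nat.card P : k) := by
    obtain ⟨n, hn⟩ := IsPGroup.iff_card.mp hP
    rw [hn, Nat.cast_pow]
    exact ⟨pow_ne_zero _ hpk⟩
  let τ : Representation k P V := ρ.comp P.subtype
  have hfin : Finite τ.asModule := inferInstanceAs (Finite V)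
  have hfaith : ∀ x : P, (∀ v : τ.asModule, MonoidAlgebra.of k P x • v = v) → x = 1 := by
    intro x hx
    have : ρ x = ρ 1 := by
      rw [map_one]
      ext v
      have := hx (τ.asModuleEquiv.symm v)
      rw [← Representation.asModuleEquiv_symm_map_rho] at this
      exact τ.asModuleEquiv.symm.injective this
    exact Subtype.ext (hρ this)
  by_cases hPc : ⁅P, P⁆ = ⊥
  · have hle := card_le_card_of_comm_of_semisimple (k := k) (P := P) (V := τ.asModule) ?_ hfaith
    · apply hcon
      refine le_trans (Nat.le_of_dvd Nat.card_pos ?_) hle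
      exact Subgroup.relIndex_dvd_card S P
    · intro x y
      exact Subtype.ext (Subgroup.mem_centralizer_iff.mp
        (Subgroup.commutator_eq_bot_iff_le_centralizer.mp hPc x.2) y y.2).symm
  · have hle := index_center_le_card_of_semisimple (k := k) (P := P) (V := τ.asModule) ?_ hfaith
    · have hZ := hcon' (Subgroup.centralizer P ⊓ P) inferInstance inf_le_right ?_
      · exact hPc (Subgroup.commutator_eq_bot_iff_le_centralizer.mpr (inf_eq_right.mp hZ))
      · rw [Subgroup.inf_relIndex_right, Subgroup.relIndex]
        have hcen : (Subgroup.centralizer (P : Set J)).subgroupOf P = Subgroup.center P := by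
          ext x
          rw [Subgroup.mem_subgroupOf, Subgroup.mem_centralizer_iff, Subgroup.mem_center_iff]
          exact ⟨fun h g => Subtype.ext (h g g.2), fun h g hg => congrArg Subtype.val (h ⟨g, hg⟩)⟩
        rw [hcen]
        exact hle
    · rw [commutator_def, Subgroup.commutator_le]
      intro a _ b _
      rw [Subgroup.mem_center_iff]
      intro g
      have h1 : ⁅(a : J), (b : J)⁆ ∈ ⁅P, P⁆ := Subgroup.commutator_mem_commutator a.2 b.2
      have h2 := Subgroup.mem_centralizer_iff.mp
        (Subgroup.commutator_eq_bot_iff_le_centralizer.mp hcl h1) g g.2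
      exact Subtype.ext h2

/-! ### Minimal normal subgroups, the Frattini subgroup and normal `p`-subgroups -/

/-- A nontrivial normal subgroup of a finite group contains a minimal normal subgroup. -/
theorem exists_minimal_normal_le {G : Type*} [Group G] [Finite G] (N : Subgroup G) [hN : N.Normal]
    (hne : N ≠ ⊥) : ∃ B ≤ N, B.Normal ∧ B ≠ ⊥ ∧
      ∀ K : Subgroup G, K.Normal → K ≤ B → K ≠ ⊥ → K = B := by
  obtain ⟨B, hBN, hB⟩ := Finite.exists_le_minimal
    (p := fun K : Subgroup G => K.Normal ∧ K ≠ ⊥) ⟨hN, hne⟩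
  exact ⟨B, hBN, hB.prop.1, hB.prop.2, fun K hK hKB hK0 =>
    le_antisymm hKB (hB.le_of_le ⟨hK, hK0⟩ hKB)⟩

open scoped commutatorElement in
theorem commutator_self_eq_bot_of_minimal_normal {G : Type*} [Group G] [Group.IsSolvable G]
    {B : Subgroup G} [B.Normal] (hne : B ≠ ⊥)
    (hmin : ∀ K : Subgroup G, K.Normal → K ≤ B → K ≠ ⊥ → K = B) : ⁅B, B⁆ = ⊥ := by
  by_contra h
  have h1 := Group.IsSolvable.commutator_lt_of_ne_bot hne
  exact h1.ne (hmin _ inferInstance h1.le h)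

theorem commute_of_commutator_self_eq_bot {G : Type*} [Group G] {B : Subgroup G}
    (h : ⁅B, B⁆ = ⊥) {a b : G} (ha : a ∈ B) (hb : b ∈ B) : a * b = b * a :=
  (Subgroup.mem_centralizer_iff.mp
    (Subgroup.commutator_eq_bot_iff_le_centralizer.mp h ha) b hb).symm

theorem isCyclic_quotient_of_isCoatom {G : Type*} [Group G] {M : Subgroup G} (hM : IsCoatom M)
    [M.Normal] : IsCyclic (G ⧸ M) := by
  obtain ⟨x, -, hx⟩ := SetLike.exists_of_lt (lt_top_iff_ne_top.mpr hM.1)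
  refine ⟨(x : G ⧸ M), fun y => ?_⟩
  have h : (Subgroup.zpowers (x : G ⧸ M)).comap (QuotientGroup.mk' M) = ⊤ := by
    refine hM.2 _ (lt_of_le_of_ne ?_ fun h => hx ?_)
    · intro m hm
      rw [Subgroup.mem_comap, QuotientGroup.mk'_apply, (QuotientGroup.eq_one_iff m).mpr hm]
      exact one_mem _
    · rw [h]
      exact Subgroup.mem_zpowers _
  obtain ⟨y, rfl⟩ := QuotientGroup.mk_surjective y
  have : y ∈ (Subgroup.zpowers (x : G ⧸ M)).comap (QuotientGroup.mk' M) := h ▸ trivial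
  exact this

theorem commutator_le_of_isCoatom {G : Type*} [Group G] {M : Subgroup G} (hM : IsCoatom M)
    [M.Normal] : commutator G ≤ M := by
  have := isCyclic_quotient_of_isCoatom hM
  have h : IsMulCommutative (G ⧸ M) := inferInstance
  exact Subgroup.Normal.quotient_commutative_iff_commutator_le.mp h

theorem isNilpotent_of_forall_commute {G : Type*} [Group G] (h : ∀ a b : G, a * b = b * a) :
    Group.IsNilpotent G :=
  let _ : CommGroup G := { ‹Group G› with mul_comm := h }
  inferInstance

/-- A finite group all of whose maximal subgroups contain the commutator subgroup is nilpotent. -/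
theorem isNilpotent_of_commutator_le_frattini {G : Type*} [Group G] [Finite G]
    (h : commutator G ≤ frattini G) : Group.IsNilpotent G :=
  (Group.isNilpotent_of_finite_tfae.out 0 2 rfl rfl).mpr fun _ hM =>
    Subgroup.Normal.of_commutator_le G (h.trans (frattini_le_coatom hM))

/-- The Sylow subgroups of a normal subgroup that is nilpotent modulo the Frattini subgroup are
normal in the whole group. -/
theorem sylow_map_normal_of_nilpotent_quotient_frattini {G : Type*} [Group G] [Finite G]
    {X : Subgroup (G ⧸ frattini G)} [X.Normal] (hX : Group.IsNilpotent X) {p : ℕ} [Fact p.Prime]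
    (Q : Sylow p (X.comap (QuotientGroup.mk' (frattini G)))) :
    (Q.toSubgroup.map (Subgroup.subtype _)).Normal := by
  let Y := X.comap (QuotientGroup.mk' (frattini G))
  obtain ⟨R, hR⟩ : ∃ R : Subgroup G, R = Q.toSubgroup.map Y.subtype := ⟨_, rfl⟩
  change (Q.toSubgroup.map Y.subtype).Normal
  rw [← hR]
  have hRY : R ≤ Y := hR ▸ Subgroup.map_subtype_le _
  have hPR : IsPGroup p R := hR ▸ Q.isPGroup'.map _
  have hsurj : Function.Surjective ((QuotientGroup.mk' (frattini G)).subgroupComap X) :=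
    (QuotientGroup.mk' (frattini G)).subgroupComap_surjective_of_surjective X
      (QuotientGroup.mk'_surjective _)
  let Q' : Sylow p X := Q.mapSurjective hsurj
  have hQ' : (Q' : Subgroup X).Characteristic :=
    Sylow.characteristic_of_normal _ inferInstance
  have hn : ((Q' : Subgroup X).map X.subtype).Normal :=
    ConjAct.normal_of_characteristic_of_normal
  have hmap : (Q' : Subgroup X).map X.subtype = R.map (QuotientGroup.mk' (frattini G)) := by
    rw [hR, Subgroup.map_map]
    change (((Q : Subgroup Y).map _).map _) = _
    rw [Subgroup.map_map]
    rfl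
  have hN : (R ⊔ frattini G).Normal := by
    have h1 := hn.comap (QuotientGroup.mk' (frattini G))
    rwa [hmap, Subgroup.comap_map_eq, QuotientGroup.ker_mk'] at h1
  have hNY : R ⊔ frattini G ≤ Y := by
    refine sup_le hRY fun x hx => ?_
    rw [Subgroup.mem_comap, QuotientGroup.mk'_apply, (QuotientGroup.eq_one_iff x).mpr hx]
    exact one_mem _
  have hidx : ¬ p ∣ (R.subgroupOf (R ⊔ frattini G)).index := by
    intro hp
    have h1 : R.relIndex (R ⊔ frattini G) * (R ⊔ frattini G).relIndex Y = R.relIndex Y :=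
      Subgroup.relIndex_mul_relIndex _ _ _ le_sup_left hNY
    have h2 : R.relIndex Y = (Q : Subgroup Y).index := by
      rw [Subgroup.relIndex, Subgroup.subgroupOf, hR,
        Subgroup.comap_map_eq_self_of_injective Y.subtype_injective]
    apply Q.not_dvd_index
    rw [← h2, ← h1]
    exact hp.mul_right _
  let S : Sylow p (R ⊔ frattini G : Subgroup G) :=
    (hPR.comap_subtype (K := R ⊔ frattini G)).toSylow hidx
  have hS : (S : Subgroup (R ⊔ frattini G : Subgroup G)).map (Subgroup.subtype _) = R := by
    change (R.subgroupOf (R ⊔ frattini G)).map _ = R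
    rw [Subgroup.subgroupOf_map_subtype, inf_eq_left.mpr le_sup_left]
  -- Frattini argument: R is Sylow in the normal subgroup RΦ, so N(R)Φ is the whole group, and Φ
  -- consists of non-generators.
  have hfr := Sylow.normalizer_sup_eq_top S
  rw [hS, ← sup_assoc, sup_eq_left.mpr Subgroup.le_normalizer] at hfr
  exact Subgroup.normalizer_eq_top_iff.mp (frattini_nongenerating hfr)

/-- A prime dividing |X : X ∩ Z| would divide the index in X of one of its Sylow subgroups. -/
theorem le_of_forall_sylow_map_le {G : Type*} [Group G] [Finite G] {X Z : Subgroup G}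
    (h : ∀ (p : ℕ) (_ : Fact p.Prime) (Q : Sylow p X), (Q : Subgroup X).map X.subtype ≤ Z) :
    X ≤ Z := by
  rw [← Subgroup.subgroupOf_eq_top, ← Subgroup.index_eq_one]
  by_contra hne
  obtain ⟨p, hp, hdvd⟩ := Nat.exists_prime_and_dvd hne
  have : Fact p.Prime := ⟨hp⟩
  obtain ⟨Q⟩ : Nonempty (Sylow p X) := inferInstance
  exact Q.not_dvd_index (hdvd.trans (Subgroup.index_dvd_of_le
    (Subgroup.map_le_iff_le_comap.mp (h p this Q))))

open scoped commutatorElement in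
/-- A finite soluble group that is not nilpotent has a normal `p`-subgroup `P` and a non-normal
maximal subgroup not containing `P`. -/
theorem exists_normal_pgroup_not_le_isCoatom {J : Type*} [Group J] [Finite J]
    [Group.IsSolvable J] (hJ : ¬ Group.IsNilpotent J) :
    ∃ (p : ℕ) (_ : Fact p.Prime) (P M : Subgroup J), P.Normal ∧ IsPGroup p P ∧ IsCoatom M ∧
      ¬ M.Normal ∧ ¬ P ≤ M := by
  by_contra! hcon
  have hcent : ∀ (p : ℕ) (_ : Fact p.Prime) (P : Subgroup J), P.Normal → IsPGroup p P →
      ⁅P, (⊤ : Subgroup J)⁆ ≤ frattini J := by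
    intro p hp P hP hPp
    refine le_iInf₂ fun M hM => ?_
    by_cases hMn : M.Normal
    · exact (Subgroup.commutator_mono le_top le_rfl).trans (commutator_le_of_isCoatom hM)
    · exact (Subgroup.commutator_le_left _ _).trans (hcon p hp P M hP hPp hM hMn)
  let C := Subgroup.center (J ⧸ frattini J)
  have hC : (⊤ : Subgroup ((J ⧸ frattini J) ⧸ C)) ≠ ⊥ := by
    intro h
    apply hJ
    apply isNilpotent_of_commutator_le_frattini
    rw [← Subgroup.Normal.quotient_commutative_iff_commutator_le]
    have h1 : C = ⊤ := by
      rw [← QuotientGroup.ker_mk' C, ← MonoidHom.comap_bot, ← h, Subgroup.comap_top]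
    refine ⟨⟨fun a b => ?_⟩⟩
    have h2 : a ∈ C := h1 ▸ trivial
    exact (Subgroup.mem_center_iff.mp h2 b).symm
  obtain ⟨B, -, hBn, hB0, hBmin⟩ := exists_minimal_normal_le _ hC
  have hBc := commutator_self_eq_bot_of_minimal_normal hB0 hBmin
  -- The preimage of B is an extension of an abelian group by a central subgroup. Its preimage in J
  -- thus has Sylow subgroups that are normal in J, hence central modulo Φ, which forces B to be
  -- trivial.
  have hX : Group.IsNilpotent (B.comap (QuotientGroup.mk' C)) := by
    have hBnil : Group.IsNilpotent B := isNilpotent_of_forall_commute fun a b =>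
      Subtype.ext (commute_of_commutator_self_eq_bot hBc a.2 b.2)
    refine Subgroup.isNilpotent_of_ker_le_center ((QuotientGroup.mk' C).subgroupComap B) ?_
    intro x hx
    have h1 : ((x : J ⧸ frattini J) : (J ⧸ frattini J) ⧸ C) = 1 := congrArg Subtype.val hx
    rw [QuotientGroup.eq_one_iff] at h1
    rw [Subgroup.mem_center_iff]
    exact fun g => Subtype.ext (Subgroup.mem_center_iff.mp h1 g)
  have hle : (B.comap (QuotientGroup.mk' C)).comap (QuotientGroup.mk' (frattini J)) ≤
      C.comap (QuotientGroup.mk' (frattini J)) := by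
    refine le_of_forall_sylow_map_le fun p hp Q => ?_
    have h1 := hcent p hp _ (sylow_map_normal_of_nilpotent_quotient_frattini hX Q)
      (Q.isPGroup'.map _)
    intro x hx
    rw [Subgroup.mem_comap, Subgroup.mem_center_iff]
    intro g
    obtain ⟨g, rfl⟩ := QuotientGroup.mk_surjective g
    have h2 : ⁅x, g⁆ ∈ frattini J := h1 (Subgroup.commutator_mem_commutator hx trivial)
    rw [← QuotientGroup.eq_one_iff, commutatorElement_def, ← commutatorElement_def] at h2
    have h3 : ⁅(x : J ⧸ frattini J), (g : J ⧸ frattini J)⁆ = 1 := h2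
    exact (commutatorElement_eq_one_iff_mul_comm.mp h3).symm
  rw [Subgroup.comap_le_comap_of_surjective (QuotientGroup.mk'_surjective _)] at hle
  apply hB0
  rw [eq_bot_iff]
  intro b hb
  obtain ⟨b, rfl⟩ := QuotientGroup.mk_surjective b
  exact (QuotientGroup.eq_one_iff b).mpr (hle hb)

/-- Every coset of M has a representative in P. -/
theorem index_le_relIndex_of_sup_eq_top {G : Type*} [Group G] [Finite G] {P M : Subgroup G}
    [P.Normal] (h : P ⊔ M = ⊤) : M.index ≤ M.relIndex P := by
  have hrep : ∀ q : G ⧸ M, ∃ x : P, ((x : G) : G ⧸ M) = q := by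
    intro q
    obtain ⟨g, rfl⟩ := QuotientGroup.mk_surjective q
    have hg : g ∈ P ⊔ M := h ▸ trivial
    obtain ⟨x, hx, m, hm, rfl⟩ := Subgroup.mem_sup_of_normal_left.mp hg
    exact ⟨⟨x, hx⟩, QuotientGroup.eq.mpr (by simpa using hm)⟩
  choose r hr using hrep
  refine Nat.card_le_card_of_injective (fun q => ((r q : P) : P ⧸ M.subgroupOf P)) ?_
  intro a b hab
  have h1 : (r a)⁻¹ * r b ∈ M.subgroupOf P := QuotientGroup.eq.mp hab
  rw [← hr a, ← hr b]
  exact QuotientGroup.eq.mpr h1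

/-! ### Irreducible linear groups over a prime field -/

/-- A normal `p`-subgroup acts trivially in an irreducible representation over a field with `p`
elements. -/
theorem apply_eq_of_normal_pgroup_of_irreducible {J V : Type*} [Group J] {p : ℕ} [Fact p.Prime]
    [AddCommGroup V] [Module (ZMod p) V] [Finite V] [Nontrivial V]
    (ρ : J →* Module.End (ZMod p) V)
    (hirr : ∀ W : Submodule (ZMod p) V, (∀ g, ∀ w ∈ W, ρ g w ∈ W) → W = ⊥ ∨ W = ⊤)
    {P : Subgroup J} [P.Normal] (hP : IsPGroup p P) : ∀ x ∈ P, ∀ v, ρ x v = v := by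
  let _ : MulAction P V := MulAction.compHom V (ρ.comp P.subtype)
  have hsmul : ∀ (x : P) (v : V), x • v = ρ x v := fun _ _ => rfl
  have hdvd : p ∣ Nat.card V := by
    cases nonempty_fintype V
    have hpos : Module.finrank (ZMod p) V ≠ 0 := Module.finrank_pos.ne'
    rw [Nat.card_eq_fintype_card, Module.card_eq_pow_finrank (K := ZMod p) (V := V), ZMod.card]
    exact dvd_pow_self p hpos
  obtain ⟨v, hv, hv0⟩ := hP.exists_fixed_point_of_prime_dvd_card_of_fixed_point V hdvd
    (a := 0) (fun x => by rw [hsmul, map_zero])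
  let W : Submodule (ZMod p) V :=
    { carrier := {v | ∀ x ∈ P, ρ x v = v}
      add_mem' := fun ha hb x hx => by rw [map_add, ha x hx, hb x hx]
      zero_mem' := fun x _ => map_zero _
      smul_mem' := fun c v hv x hx => by rw [map_smul, hv x hx] }
  have hW : W = ⊤ := by
    refine (hirr W fun g w hw x hx => ?_).resolve_left fun h => hv0 ?_
    · have h1 := hw (g⁻¹ * x * g) (by simpa using ‹P.Normal›.conj_mem x hx g⁻¹)
      rw [← Module.End.mul_apply, ← map_mul]
      nth_rewrite 2 [← h1]
      rw [← Module.End.mul_apply, ← map_mul]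
      congr 2
      group
    · have : v ∈ W := fun x hx => hv ⟨x, hx⟩
      rw [h] at this
      exact this.symm
  intro x hx v
  have : v ∈ W := hW ▸ trivial
  exact this x hx

/-- A finite soluble non-nilpotent irreducible linear group on a space `V` of prime characteristic
has a non-normal maximal subgroup of index less than `|V|`. -/
theorem exists_nonnormal_isCoatom_index_lt {J V : Type*} [Group J] [Finite J] [Group.IsSolvable J]
    (hJ : ¬ Group.IsNilpotent J) {b : ℕ} [hb : Fact b.Prime] [AddCommGroup V] [Module (ZMod b) V]
    [Finite V] [Nontrivial V] (ρ : J →* Module.End (ZMod b) V) (hρ : Function.Injective ρ)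
    (hirr : ∀ W : Submodule (ZMod b) V, (∀ g, ∀ w ∈ W, ρ g w ∈ W) → W = ⊥ ∨ W = ⊤) :
    ∃ M : Subgroup J, IsCoatom M ∧ ¬ M.Normal ∧ M.index < Nat.card V := by
  obtain ⟨p, hp, P₀, M, hP₀, hP₀p, hM, hMn, hP₀M⟩ := exists_normal_pgroup_not_le_isCoatom hJ
  -- Minimality puts every smaller normal subgroup of J inside M, so M can play the role of S in the
  -- relative index bound.
  obtain ⟨P, hPP₀, hPmin⟩ := Finite.exists_le_minimal
    (p := fun K : Subgroup J => K.Normal ∧ ¬ K ≤ M) ⟨hP₀, hP₀M⟩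
  obtain ⟨hPn, hPM⟩ := hPmin.prop
  have hPp : IsPGroup p P := hP₀p.to_le hPP₀
  have hpb : p ≠ b := by
    rintro rfl
    apply hPM
    intro x hx
    have h1 : ρ x = ρ 1 := by
      rw [map_one]
      ext v
      exact apply_eq_of_normal_pgroup_of_irreducible ρ hirr hPp x hx v
    rw [hρ h1]
    exact one_mem M
  have hpk : (p : ZMod b) ≠ 0 := by
    rw [Ne, ZMod.natCast_eq_zero_iff, Nat.prime_dvd_prime_iff_eq hb.out hp.out]
    exact hpb.symm
  have hle := relIndex_le_card_of_normal_pgroup ρ hρ hpk P M hPp fun Y hY hYP => by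
    by_contra h
    exact hYP.not_ge (hPmin.le_of_le ⟨hY, h⟩ hYP.le)
  refine ⟨M, hM, hMn, lt_of_le_of_lt (index_le_relIndex_of_sup_eq_top (P := P) ?_)
    (lt_of_le_of_ne hle fun heq => ?_)⟩
  · rw [sup_comm]
    exact hM.2 _ (left_lt_sup.mpr hPM)
  -- Equality would make |V|, divisible by b, a divisor of a power of p ≠ b.
  · obtain ⟨n, hn⟩ := IsPGroup.iff_card.mp hPp
    have h1 : Nat.card V ∣ p ^ n := by
      rw [← heq, ← hn]
      exact Subgroup.relIndex_dvd_card M P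
    have h2 : b ∣ Nat.card V := by
      cases nonempty_fintype V
      rw [Nat.card_eq_fintype_card, Module.card_eq_pow_finrank (K := ZMod b) (V := V), ZMod.card]
      exact dvd_pow_self b Module.finrank_pos.ne'
    exact hpb ((Nat.prime_dvd_prime_iff_eq hb.out hp.out).mp
      (hb.out.dvd_of_dvd_pow (h2.trans h1))).symm

/-! ### Upper bounds for covering numbers -/

theorem coveringNumber_le_card {G ι : Type*} [Group G] [Finite ι] (H : ι → Subgroup G)
    (hne : ∀ i, H i ≠ ⊤) (hcov : ∀ g, ∃ i, g ∈ H i) : coveringNumber G ≤ Nat.card ι := by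
  refine Nat.sInf_le ⟨fun i => H ((Finite.equivFin ι).symm i), fun i => hne _, ?_⟩
  ext g
  simp only [Set.mem_iUnion, SetLike.mem_coe, Set.mem_univ, iff_true]
  obtain ⟨i, hi⟩ := hcov g
  exact ⟨Finite.equivFin ι i, by simpa using hi⟩

theorem exists_cover {G : Type*} [Group G] [Finite G] (hG : ¬ IsCyclic G) :
    ∃ H : Fin (coveringNumber G) → Subgroup G, (∀ i, H i ≠ ⊤) ∧ ∀ g, ∃ i, g ∈ H i := by
  obtain ⟨H, h1, h2⟩ := (coveringNumber_isLeast G hG).1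
  refine ⟨H, h1, fun g => ?_⟩
  have : g ∈ ⋃ i, (H i : Set G) := h2 ▸ trivial
  simpa using this

theorem coveringNumber_le_of_surjective {G H : Type*} [Group G] [Group H] [Finite H]
    (hH : ¬ IsCyclic H) (f : G →* H) (hf : Function.Surjective f) :
    coveringNumber G ≤ coveringNumber H := by
  obtain ⟨K, h1, h2⟩ := exists_cover hH
  refine (coveringNumber_le_card (fun i => (K i).comap f) (fun i h => h1 i ?_)
    fun g => h2 (f g)).trans_eq (Nat.card_fin _)
  rw [← Subgroup.map_comap_eq_self_of_surjective hf (K i), h, Subgroup.map_top_of_surjective f hf]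

theorem index_prime_of_isCoatom {G : Type*} [Group G] [Finite G] {M : Subgroup G}
    (hM : IsCoatom M) [M.Normal] : M.index.Prime := by
  have hcyc := isCyclic_quotient_of_isCoatom hM
  have : IsMulCommutative (G ⧸ M) := inferInstance
  have hs : IsSimpleGroup (G ⧸ M) := by
    refine { exists_pair_ne := ?_, eq_bot_or_eq_top_of_normal := fun K _ => ?_ }
    · obtain ⟨x, -, hx⟩ := SetLike.exists_of_lt (lt_top_iff_ne_top.mpr hM.1)
      exact ⟨x, 1, fun h => hx ((QuotientGroup.eq_one_iff x).mp h)⟩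
    · have hle : M ≤ K.comap (QuotientGroup.mk' M) := by
        intro m hm
        rw [Subgroup.mem_comap, QuotientGroup.mk'_apply, (QuotientGroup.eq_one_iff m).mpr hm]
        exact one_mem _
      rw [← Subgroup.map_comap_eq_self_of_surjective (QuotientGroup.mk'_surjective M) K]
      rcases hle.eq_or_lt with h | h
      · left
        rw [← h, eq_bot_iff]
        rintro _ ⟨m, hm, rfl⟩
        exact (QuotientGroup.eq_one_iff m).mpr hm
      · right
        rw [hM.2 _ h]
        exact Subgroup.map_top_of_surjective _ (QuotientGroup.mk'_surjective M)
  exact Group.is_simple_iff_prime_card.mp hs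

theorem exists_hom_zmod_ker_eq {G : Type*} [Group G] {p : ℕ} [Fact p.Prime] {M : Subgroup G}
    [M.Normal] (h : M.index = p) : ∃ f : G →* Multiplicative (ZMod p), f.ker = M := by
  have h1 : Nat.card (G ⧸ M) = Nat.card (Multiplicative (ZMod p)) := by
    rw [Nat.card_congr Multiplicative.toAdd, Nat.card_zmod]
    exact h
  let e : G ⧸ M ≃* Multiplicative (ZMod p) := mulEquivOfPrimeCardEq (p := p) h
    (by rw [Nat.card_congr Multiplicative.toAdd, Nat.card_zmod])
  refine ⟨e.toMonoidHom.comp (QuotientGroup.mk' M), ?_⟩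
  ext x
  rw [MonoidHom.mem_ker]
  change e (x : G ⧸ M) = 1 ↔ _
  rw [MulEquiv.map_eq_one_iff, QuotientGroup.eq_one_iff]

/-- A group with two distinct normal maximal subgroups of index `p` is the union of `p + 1` proper
subgroups. -/
theorem coveringNumber_le_prime_add_one {G : Type*} [Group G] {p : ℕ} [Fact p.Prime]
    {M₁ M₂ : Subgroup G} [M₁.Normal] [M₂.Normal] (h₁ : IsCoatom M₁) (h₂ : IsCoatom M₂)
    (hne : M₁ ≠ M₂) (hi₁ : M₁.index = p) (hi₂ : M₂.index = p) : coveringNumber G ≤ p + 1 := by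
  obtain ⟨f₁, hf₁⟩ := exists_hom_zmod_ker_eq hi₁
  obtain ⟨f₂, hf₂⟩ := exists_hom_zmod_ker_eq hi₂
  -- Together with M₁ these are the preimages of the p + 1 lines in the plane over the field with p
  -- elements.
  let K : ZMod p → Subgroup G := fun c =>
    { carrier := {g | (f₂ g).toAdd = c * (f₁ g).toAdd}
      one_mem' := by simp
      mul_mem' := by
        intro a b ha hb
        simp only [Set.mem_ofPred_eq, map_mul, toAdd_mul] at *
        rw [ha, hb, mul_add]
      inv_mem' := by
        intro a ha
        simp only [Set.mem_ofPred_eq, map_inv, toAdd_inv] at *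
        rw [ha, mul_neg] }
  have hK : ∀ c g, g ∈ K c ↔ (f₂ g).toAdd = c * (f₁ g).toAdd := fun _ _ => Iff.rfl
  have hle := coveringNumber_le_card (fun o : Option (ZMod p) => o.elim M₁ K) ?_ ?_
  · rwa [Finite.card_option, Nat.card_zmod] at hle
  · rintro (_ | c)
    · exact h₁.1
    · intro h
      have h : K c = ⊤ := h
      apply hne
      have hle : M₁ ≤ M₂ := by
        intro x hx
        rw [← hf₁, MonoidHom.mem_ker] at hx
        rw [← hf₂, MonoidHom.mem_ker]
        have h3 : x ∈ K c := h ▸ trivial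
        rw [hK, hx, toAdd_one, mul_zero] at h3
        exact h3
      exact (h₁.le_iff_eq h₂.1).mp hle |>.symm
  · intro g
    by_cases hg : g ∈ M₁
    · exact ⟨none, hg⟩
    · refine ⟨some ((f₂ g).toAdd / (f₁ g).toAdd), ?_⟩
      change g ∈ K _
      rw [hK, div_mul_cancel₀]
      intro h0
      exact hg (hf₁ ▸ h0)

/-- Maximal subgroups of a p-group are normal of index p, and a non-cyclic group has at least two,
since each of its elements lies in one. -/
theorem coveringNumber_le_of_pgroup {P : Type*} [Group P] [Finite P] {p : ℕ} [Fact p.Prime]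
    (hP : IsPGroup p P) (hc : ¬ IsCyclic P) : coveringNumber P ≤ p + 1 := by
  have hnil : Group.IsNilpotent P := hP.isNilpotent
  have hnorm : ∀ M : Subgroup P, IsCoatom M → M.Normal :=
    (Group.isNilpotent_of_finite_tfae.out 0 2 rfl rfl).mp hnil
  have hidx : ∀ M : Subgroup P, IsCoatom M → M.index = p := by
    intro M hM
    have := hnorm M hM
    have hpr := index_prime_of_isCoatom hM
    obtain ⟨n, hn⟩ := hP.index M
    rw [hn] at hpr ⊢
    rw [(Nat.Prime.eq_one_of_pow hpr : n = 1), pow_one]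
  have hex : ∀ x : P, ∃ M : Subgroup P, IsCoatom M ∧ x ∈ M := by
    intro x
    rcases eq_top_or_exists_le_coatom (Subgroup.zpowers x) with h | ⟨M, hM, hxM⟩
    · exact absurd ⟨x, fun y => (Subgroup.eq_top_iff' _).mp h y⟩ hc
    · exact ⟨M, hM, hxM (Subgroup.mem_zpowers x)⟩
  obtain ⟨M₁, hM₁, -⟩ := hex 1
  obtain ⟨x, -, hx⟩ := SetLike.exists_of_lt (lt_top_iff_ne_top.mpr hM₁.1)
  obtain ⟨M₂, hM₂, hx₂⟩ := hex x
  have := hnorm M₁ hM₁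
  have := hnorm M₂ hM₂
  exact coveringNumber_le_prime_add_one hM₁ hM₂ (fun h => hx (h ▸ hx₂)) (hidx _ hM₁) (hidx _ hM₂)

/-- A finite nilpotent non-cyclic group acting faithfully on `V` is the union of at most `|V|`
proper subgroups. -/
theorem coveringNumber_le_card_of_nilpotent {J k V : Type*} [Group J] [Finite J]
    (hJ : Group.IsNilpotent J) (hc : ¬ IsCyclic J) [Field k] [AddCommGroup V] [Module k V]
    [Finite V] (ρ : J →* Module.End k V) (hρ : Function.Injective ρ) :
    coveringNumber J ≤ Nat.card V := by
  obtain ⟨p, hp, P, hPc⟩ : ∃ (p : ℕ) (_ : p.Prime) (P : Sylow p J), ¬ IsCyclic P := by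
    by_contra! h
    have : IsZGroup J := ⟨h⟩
    exact hc inferInstance
  have : Fact p.Prime := ⟨hp⟩
  have hPn : Nontrivial P := by
    by_contra h
    rw [not_nontrivial_iff_subsingleton] at h
    exact hPc inferInstance
  have hpJ : p ∈ (Nat.card J).primeFactors := by
    rw [Nat.mem_primeFactors]
    refine ⟨hp, ?_, Nat.card_pos.ne'⟩
    obtain ⟨n, hn, h⟩ := P.isPGroup'.nontrivial_iff_card.mp hPn
    exact (dvd_pow_self p hn.ne').trans (h ▸ Subgroup.card_subgroup_dvd_card _)
  obtain ⟨e⟩ := (Group.isNilpotent_of_finite_tfae.out 0 4 rfl rfl).mp hJ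
  let f : J →* P :=
    ((Pi.evalMonoidHom (fun Q : Sylow p J => (Q : Subgroup J)) P).comp
      (Pi.evalMonoidHom (fun q : (Nat.card J).primeFactors => ∀ Q : Sylow q J, (Q : Subgroup J))
        ⟨p, hpJ⟩)).comp e.symm.toMonoidHom
  have hf : Function.Surjective f := by
    classical
    have h1 := Function.surjective_eval (β := fun Q : Sylow p J => (Q : Subgroup J)) P
    have h2 := Function.surjective_eval
      (β := fun q : (Nat.card J).primeFactors => ∀ Q : Sylow q J, (Q : Subgroup J)) ⟨p, hpJ⟩
    intro y
    obtain ⟨z, rfl⟩ := h1 y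
    obtain ⟨z, rfl⟩ := h2 z
    obtain ⟨z, rfl⟩ := e.symm.surjective z
    exact ⟨z, rfl⟩
  refine (coveringNumber_le_of_surjective hPc f hf).trans
    ((coveringNumber_le_of_pgroup P.isPGroup' hPc).trans ?_)
  let _ : MulAction P V := MulAction.compHom V (ρ.comp P.toSubgroup.subtype)
  have hsmul : ∀ (x : P) (v : V), x • v = ρ x v := fun _ _ => rfl
  obtain ⟨x, hx⟩ := exists_ne (1 : P)
  obtain ⟨v, hv⟩ : ∃ v, ρ x v ≠ v := by
    by_contra! h
    apply hx
    have h1 : ρ x = ρ 1 := by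
      rw [map_one]
      ext v
      exact h v
    exact Subtype.ext (hρ h1)
  -- The orbit of a moved vector has at least p points and misses 0, so p + 1 ≤ |V|.
  obtain ⟨n, hn⟩ := P.isPGroup'.card_orbit v
  have hn0 : n ≠ 0 := by
    rintro rfl
    rw [pow_zero, Nat.card_eq_one_iff_unique] at hn
    have := hn.1
    have h2 := congrArg Subtype.val (Subsingleton.elim
      (⟨x • v, MulAction.mem_orbit v x⟩ : MulAction.orbit P v) ⟨v, MulAction.mem_orbit_self v⟩)
    exact hv h2
  have hle : p ≤ Nat.card (MulAction.orbit P v) := hn ▸ Nat.le_self_pow hn0 p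
  have h0 : (0 : V) ∉ MulAction.orbit P v := by
    rintro ⟨y, hy⟩
    have hy : ρ y v = 0 := hy
    have h3 : v = 0 := by
      have := congrArg (ρ (y : J)⁻¹) hy
      rwa [← Module.End.mul_apply, ← map_mul, inv_mul_cancel, map_one, map_zero] at this
    rw [h3, map_zero] at hv
    exact hv rfl
  calc p + 1 ≤ (MulAction.orbit P v).ncard + 1 := Nat.add_le_add_right hle 1
    _ = (insert 0 (MulAction.orbit P v)).ncard := (Set.ncard_insert_of_notMem h0).symm
    _ ≤ Nat.card V := Set.ncard_le_card _

/-! ### Soluble groups with a core-free maximal subgroup -/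

theorem normal_of_sup_eq_top_of_le_normalizer {G : Type*} [Group G] {A B K : Subgroup G}
    (h : A ⊔ B = ⊤) (hA : ∀ a ∈ A, ∀ x ∈ K, a * x * a⁻¹ ∈ K)
    (hB : ∀ b ∈ B, ∀ x ∈ K, b * x * b⁻¹ ∈ K) : K.Normal := by
  have hmem : ∀ {C : Subgroup G}, (∀ a ∈ C, ∀ x ∈ K, a * x * a⁻¹ ∈ K) →
      C ≤ Subgroup.normalizer (K : Set G) := by
    intro C hC a ha
    rw [Subgroup.mem_normalizer_iff]
    refine fun x => ⟨hC a ha x, fun hx => ?_⟩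
    have := hC a⁻¹ (C.inv_mem ha) _ hx
    rwa [inv_inv, ← mul_assoc, ← mul_assoc, inv_mul_cancel, one_mul, inv_mul_cancel_right] at this
  rw [← Subgroup.normalizer_eq_top_iff, eq_top_iff, ← h]
  exact sup_le (hmem hA) (hmem hB)

theorem pow_prime_eq_one_of_minimal_normal {G : Type*} [Group G] [Finite G] {B : Subgroup G}
    [B.Normal] (hB0 : B ≠ ⊥) (hmin : ∀ K : Subgroup G, K.Normal → K ≤ B → K ≠ ⊥ → K = B)
    (hcomm : ∀ a ∈ B, ∀ b ∈ B, a * b = b * a) : ∃ p : ℕ, p.Prime ∧ ∀ x ∈ B, x ^ p = 1 := by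
  have hcard : Nat.card B ≠ 1 := fun h => hB0 (Subgroup.card_eq_one.mp h)
  obtain ⟨p, hp, hdvd⟩ := Nat.exists_prime_and_dvd hcard
  have : Fact p.Prime := ⟨hp⟩
  refine ⟨p, hp, ?_⟩
  let K : Subgroup G :=
    { carrier := {x | x ∈ B ∧ x ^ p = 1}
      one_mem' := ⟨one_mem B, one_pow p⟩
      mul_mem' := by
        rintro a b ⟨ha, ha'⟩ ⟨hb, hb'⟩
        have : Commute a b := hcomm a ha b hb
        exact ⟨mul_mem ha hb, by rw [this.mul_pow, ha', hb', one_mul]⟩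
      inv_mem' := by
        rintro a ⟨ha, ha'⟩
        exact ⟨inv_mem ha, by rw [inv_pow, ha', inv_one]⟩ }
  have hK : K.Normal := ⟨fun x hx g => ⟨‹B.Normal›.conj_mem x hx.1 g, by
    rw [conj_pow, hx.2, mul_one, mul_inv_cancel]⟩⟩
  have hKB : K = B := by
    refine hmin K hK (fun x hx => hx.1) fun h0 => ?_
    obtain ⟨x, hx⟩ := exists_prime_orderOf_dvd_card' p hdvd
    have hxK : (x : G) ∈ K := ⟨x.2, by
      rw [← Subgroup.coe_pow, ← hx, pow_orderOf_eq_one, Subgroup.coe_one]⟩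
    rw [h0, Subgroup.mem_bot] at hxK
    have : x = 1 := Subtype.ext hxK
    rw [this, orderOf_one] at hx
    exact hp.one_lt.ne hx
  intro x hx
  rw [← hKB] at hx
  exact hx.2

/-- The socle of a finite soluble primitive group with point stabilizer `L`. -/
theorem exists_socle_of_normalCore_eq_bot {Q : Type*} [Group Q] [Finite Q] [Group.IsSolvable Q]
    {L : Subgroup Q} (hL : IsCoatom L) (hLn : ¬ L.Normal) (hcore : L.normalCore = ⊥) :
    ∃ B : Subgroup Q, B.Normal ∧ B ≠ ⊥ ∧
      (∀ K : Subgroup Q, K.Normal → K ≤ B → K ≠ ⊥ → K = B) ∧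
      (∀ a ∈ B, ∀ b ∈ B, a * b = b * a) ∧ B ⊔ L = ⊤ ∧ B ⊓ L = ⊥ ∧
      ∀ g, (∀ b ∈ B, g * b = b * g) → g ∈ B := by
  have hnt : (⊤ : Subgroup Q) ≠ ⊥ := by
    intro h
    apply hLn
    have : L = ⊥ := le_bot_iff.mp (h ▸ le_top)
    rw [this]
    infer_instance
  obtain ⟨B, -, hBn, hB0, hmin⟩ := exists_minimal_normal_le (⊤ : Subgroup Q) hnt
  have hcomm : ∀ a ∈ B, ∀ b ∈ B, a * b = b * a := fun a ha b hb =>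
    commute_of_commutator_self_eq_bot (commutator_self_eq_bot_of_minimal_normal hB0 hmin) ha hb
  have hsmall : ∀ K : Subgroup Q, K.Normal → K ≤ L → K = ⊥ := by
    intro K hK hKL
    rw [← le_bot_iff, ← hcore]
    exact Subgroup.normal_le_normalCore.mpr hKL
  have hBL : ¬ B ≤ L := fun h => hB0 (hsmall B hBn h)
  have hsup : B ⊔ L = ⊤ := by
    rw [sup_comm]
    exact hL.2 _ (left_lt_sup.mpr hBL)
  have hinf : B ⊓ L = ⊥ := by
    refine hsmall _ (normal_of_sup_eq_top_of_le_normalizer hsup ?_ ?_) inf_le_right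
    · rintro b hb x ⟨hx, hxL⟩
      rw [hcomm b hb x hx, mul_inv_cancel_right]
      exact ⟨hx, hxL⟩
    · rintro l hl x ⟨hx, hxL⟩
      exact ⟨hBn.conj_mem x hx l, mul_mem (mul_mem hl hxL) (L.inv_mem hl)⟩
  refine ⟨B, hBn, hB0, hmin, hcomm, hsup, hinf, ?_⟩
  have hcent : L ⊓ Subgroup.centralizer (B : Set Q) = ⊥ := by
    refine hsmall _ (normal_of_sup_eq_top_of_le_normalizer hsup ?_ ?_) inf_le_left
    · rintro b hb x ⟨hxL, hx⟩
      rw [Subgroup.mem_centralizer_iff.mp hx b hb, mul_inv_cancel_right]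
      exact ⟨hxL, hx⟩
    · rintro l hl x ⟨hxL, hx⟩
      exact ⟨mul_mem (mul_mem hl hxL) (L.inv_mem hl),
        (inferInstance : (Subgroup.centralizer (B : Set Q)).Normal).conj_mem x hx l⟩
  intro g hg
  have hgt : g ∈ B ⊔ L := hsup ▸ trivial
  obtain ⟨b, hb, l, hl, rfl⟩ := Subgroup.mem_sup_of_normal_left.mp hgt
  have hlc : l ∈ L ⊓ Subgroup.centralizer (B : Set Q) := by
    refine ⟨hl, Subgroup.mem_centralizer_iff.mpr fun c hc => ?_⟩
    have h1 := hg c hc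
    rw [mul_assoc, ← mul_assoc c, hcomm c hc b hb, mul_assoc] at h1
    exact (mul_left_cancel h1).symm
  rw [hcent, Subgroup.mem_bot] at hlc
  rw [hlc, mul_one]
  exact hb

theorem card_eq_index_of_normal_complement {G : Type*} [Group G] {B L : Subgroup G} [B.Normal]
    (hsup : B ⊔ L = ⊤) (hinf : B ⊓ L = ⊥) : Nat.card B = L.index := by
  have h : Subgroup.IsComplement' B L := by
    refine Subgroup.isComplement'_of_disjoint_and_mul_eq_univ (disjoint_iff.mpr hinf) ?_
    rw [← Subgroup.normal_mul, hsup, Subgroup.coe_top]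
  exact h.index_eq_card.symm

/-- If `L` is an abelian maximal subgroup of a finite group with an abelian normal complement `B`
which is its own centralizer and minimal normal, then `B` and the conjugates of `L` cover. -/
theorem coveringNumber_le_of_commutative_complement {Q : Type*} [Group Q] [Finite Q]
    {B L : Subgroup Q} [B.Normal] (hL : L ≠ ⊥)
    (hmin : ∀ K : Subgroup Q, K.Normal → K ≤ B → K ≠ ⊥ → K = B)
    (hcomm : ∀ a ∈ B, ∀ b ∈ B, a * b = b * a) (hsup : B ⊔ L = ⊤) (hinf : B ⊓ L = ⊥)
    (hcent : ∀ g, (∀ b ∈ B, g * b = b * g) → g ∈ B) (hB0 : B ≠ ⊥)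
    (hLc : ∀ a ∈ L, ∀ b ∈ L, a * b = b * a) : coveringNumber Q ≤ Nat.card B + 1 := by
  -- As L is abelian, the centralizer of l in B is normal in Q; by minimality it is trivial or B,
  -- and the latter would put l in B ∩ L.
  have hfix : ∀ l ∈ L, l ≠ 1 → ∀ b ∈ B, l * b = b * l → b = 1 := by
    intro l hl hl1 b hb hlb
    have hlB : l ∉ B := fun h => hl1 (by
      have : l ∈ B ⊓ L := ⟨h, hl⟩
      rwa [hinf, Subgroup.mem_bot] at this)
    let K : Subgroup Q := B ⊓ Subgroup.centralizer {l}
    have hK : ∀ x, x ∈ K ↔ x ∈ B ∧ l * x = x * l := by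
      intro x
      simp only [K, Subgroup.mem_inf, Subgroup.mem_centralizer_singleton_iff]
      exact and_congr_right fun _ => eq_comm
    have hKn : K.Normal := by
      refine normal_of_sup_eq_top_of_le_normalizer hsup ?_ ?_
      · intro c hc x hx
        rw [hcomm c hc x ((hK x).mp hx).1, mul_inv_cancel_right]
        exact hx
      · intro c hc x hx
        rw [hK] at hx ⊢
        refine ⟨‹B.Normal›.conj_mem x hx.1 c, ?_⟩
        have h1 : l * c = c * l := hLc l hl c hc
        have h2 : c⁻¹ * l = l * c⁻¹ := hLc c⁻¹ (inv_mem hc) l hl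
        rw [← mul_assoc, ← mul_assoc, h1, mul_assoc c l x, hx.2, mul_assoc _ c⁻¹ l, h2]
        group
    by_contra hb1
    have hKB : K = B := hmin K hKn inf_le_left fun h0 => hb1 (by
      have : b ∈ K := (hK b).mpr ⟨hb, hlb⟩
      rwa [h0, Subgroup.mem_bot] at this)
    refine hlB (hcent l fun x hx => ?_)
    rw [← hKB] at hx
    exact ((hK x).mp hx).2
  have hLtop : L ≠ ⊤ := by
    rintro rfl
    rw [inf_top_eq] at hinf
    exact hB0 hinf
  have hle := coveringNumber_le_card
    (fun o : Option B => o.elim B fun b => L.map (MulAut.conj (b : Q)).toMonoidHom) ?_ ?_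
  · rwa [Finite.card_option] at hle
  · rintro (_ | b)
    · intro h
      have h : B = ⊤ := h
      rw [h, top_inf_eq] at hinf
      exact hL hinf
    · intro h
      apply hLtop
      have h : L.map (MulAut.conj (b : Q)).toMonoidHom = ⊤ := h
      rw [← Subgroup.comap_map_eq_self_of_injective
        (f := (MulAut.conj (b : Q)).toMonoidHom) (MulAut.conj (b : Q)).injective L]
      exact (congrArg _ h).trans (Subgroup.comap_top _)
  · intro g
    have hg : g ∈ B ⊔ L := hsup ▸ trivial
    obtain ⟨x, hx, l, hl, rfl⟩ := Subgroup.mem_sup_of_normal_left.mp hg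
    by_cases hl1 : l = 1
    · refine ⟨none, ?_⟩
      rw [hl1, mul_one]
      exact hx
    -- Absence of fixed points makes this map injective, hence onto, so the whole coset Bl consists
    -- of B-conjugates of l.
    · let f : B → B := fun y => ⟨y * (l * (y : Q)⁻¹ * l⁻¹),
        mul_mem y.2 (‹B.Normal›.conj_mem _ (inv_mem y.2) l)⟩
      have hf : Function.Injective f := by
        intro y z hyz
        have h1 : (y : Q) * (l * (y : Q)⁻¹ * l⁻¹) = z * (l * (z : Q)⁻¹ * l⁻¹) :=
          congrArg Subtype.val hyz
        have h2 : (z : Q)⁻¹ * y = 1 := by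
          refine hfix l hl hl1 _ (mul_mem (inv_mem z.2) y.2) ?_
          have h3 : (y : Q) * l * (y : Q)⁻¹ = z * l * (z : Q)⁻¹ := by
            have := congrArg (· * l) h1
            simpa [mul_assoc] using this
          calc l * ((z : Q)⁻¹ * y) = (z : Q)⁻¹ * (z * l * (z : Q)⁻¹) * y := by group
            _ = (z : Q)⁻¹ * (y * l * (y : Q)⁻¹) * y := by rw [h3]
            _ = (z : Q)⁻¹ * y * l := by group
        exact Subtype.ext (inv_mul_eq_one.mp h2).symm
      obtain ⟨y, hy⟩ := Finite.surjective_of_injective hf ⟨x, hx⟩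
      refine ⟨some y, l, hl, ?_⟩
      have h1 : (y : Q) * (l * (y : Q)⁻¹ * l⁻¹) = x := congrArg Subtype.val hy
      change (y : Q) * l * (y : Q)⁻¹ = x * l
      rw [← h1]
      group

/-- Let `L` be a non-normal maximal subgroup with trivial core of a finite soluble group. If `L`
has minimal index among the non-normal maximal subgroups then `σ ≤ |Q : L| + 1`. -/
theorem coveringNumber_le_index_add_one_of_normalCore_eq_bot {Q : Type*} [Group Q] [Finite Q]
    [Group.IsSolvable Q] {L : Subgroup Q} (hL : IsCoatom L) (hLn : ¬ L.Normal)
    (hcore : L.normalCore = ⊥)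
    (hminidx : ∀ M : Subgroup Q, IsCoatom M → ¬ M.Normal → L.index ≤ M.index) :
    coveringNumber Q ≤ L.index + 1 := by
  obtain ⟨B, hBn, hB0, hmin, hcomm, hsup, hinf, hcent⟩ :=
    exists_socle_of_normalCore_eq_bot hL hLn hcore
  obtain ⟨p, hp, hpow⟩ := pow_prime_eq_one_of_minimal_normal hB0 hmin hcomm
  have : Fact p.Prime := ⟨hp⟩
  have hcard := card_eq_index_of_normal_complement hsup hinf
  obtain ⟨V, _, _, ⟨e⟩⟩ : ∃ (V : Type _) (_ : AddCommGroup V) (_ : Module (ZMod p) V),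
      Nonempty (Additive B ≃+ V) :=
    let i₁ : AddCommGroup (Additive B) := { (inferInstance : AddGroup (Additive B)) with
      add_comm := fun a b => Subtype.ext (hcomm a.toMul a.toMul.2 b.toMul b.toMul.2) }
    ⟨Additive B, i₁, AddCommGroup.zmodModule fun x => Subtype.ext (hpow x.toMul x.toMul.2),
      ⟨AddEquiv.refl _⟩⟩
  have hfin : Finite V := Finite.of_equiv _ e.toEquiv
  have hcardV : Nat.card V = Nat.card B := (Nat.card_congr e.toEquiv).symm
  have hnt : Nontrivial V := by
    have := (Subgroup.nontrivial_iff_ne_bot B).mpr hB0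
    exact (e.toEquiv.symm.trans Additive.toMul).nontrivial
  let ρ₀ : Q →* Module.End (ZMod p) V :=
    { toFun := fun g => ((e.symm.trans (MulEquiv.toAdditive
        (MulAut.conjNormal g : B ≃* B))).trans e).toAddMonoidHom.toZModLinearMap p
      map_one' := by
        ext v
        simp
      map_mul' := fun g h => by
        ext v
        simp }
  have hρ₀ : ∀ (g : Q) (x : B),
      ρ₀ g (e (Additive.ofMul x)) = e (Additive.ofMul (MulAut.conjNormal g x)) := by
    intro g x
    simp [ρ₀]
  have hsurjV : ∀ v, ∃ x : B, e (Additive.ofMul x) = v := fun v =>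
    ⟨(e.symm v).toMul, by simp⟩
  have hker : ∀ g, ρ₀ g = 1 ↔ g ∈ B := by
    intro g
    constructor
    · intro hg
      refine hcent g fun b hb => ?_
      have h1 := hρ₀ g ⟨b, hb⟩
      rw [hg, Module.End.one_apply] at h1
      have h2 : b = g * b * g⁻¹ := by
        have := congrArg Subtype.val (Additive.ofMul.injective (e.injective h1))
        rwa [MulAut.conjNormal_apply] at this
      exact eq_mul_inv_iff_mul_eq.mp h2 |>.symm
    · intro hg
      ext v
      obtain ⟨x, rfl⟩ := hsurjV v
      rw [hρ₀, Module.End.one_apply]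
      congr 2
      refine Subtype.ext ?_
      rw [MulAut.conjNormal_apply, hcomm g hg x x.2, mul_inv_cancel_right]
  -- Conjugation on B, viewed as a vector space. It is faithful on Q/B because B is its own
  -- centralizer, and irreducible because B is minimal normal.
  let ρ : Q ⧸ B →* Module.End (ZMod p) V := QuotientGroup.lift B ρ₀ fun g hg => (hker g).mpr hg
  have hρ : Function.Injective ρ := by
    rw [injective_iff_map_eq_one]
    intro q hq
    obtain ⟨g, rfl⟩ := QuotientGroup.mk_surjective q
    exact (QuotientGroup.eq_one_iff g).mpr ((hker g).mp hq)
  have hirr : ∀ W : Submodule (ZMod p) V, (∀ g, ∀ w ∈ W, ρ g w ∈ W) → W = ⊥ ∨ W = ⊤ := by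
    intro W hW
    let K : Subgroup Q :=
      { carrier := {x | ∃ h : x ∈ B, e (Additive.ofMul ⟨x, h⟩) ∈ W}
        one_mem' := ⟨one_mem B, by
          have : e (Additive.ofMul (1 : B)) = 0 := by rw [ofMul_one, map_zero]
          exact this ▸ zero_mem W⟩
        mul_mem' := by
          rintro a b ⟨ha, ha'⟩ ⟨hb, hb'⟩
          refine ⟨mul_mem ha hb, ?_⟩
          have : e (Additive.ofMul ((⟨a, ha⟩ : B) * ⟨b, hb⟩)) =
            e (Additive.ofMul ⟨a, ha⟩) + e (Additive.ofMul ⟨b, hb⟩) := by rw [ofMul_mul, map_add]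
          exact this ▸ add_mem ha' hb'
        inv_mem' := by
          rintro a ⟨ha, ha'⟩
          refine ⟨inv_mem ha, ?_⟩
          have : e (Additive.ofMul (⟨a, ha⟩ : B)⁻¹) = -e (Additive.ofMul ⟨a, ha⟩) := by
            rw [ofMul_inv, map_neg]
          exact this ▸ neg_mem ha' }
    have hKn : K.Normal := by
      refine ⟨?_⟩
      rintro x ⟨hx, hx'⟩ g
      refine ⟨hBn.conj_mem x hx g, ?_⟩
      have h1 := hW (g : Q ⧸ B) _ hx'
      change ρ₀ g _ ∈ W at h1
      rw [hρ₀] at h1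
      exact h1
    by_cases hK0 : K = ⊥
    · left
      rw [eq_bot_iff]
      intro v hv
      obtain ⟨x, rfl⟩ := hsurjV v
      have hxK : (x : Q) ∈ K := ⟨x.2, hv⟩
      rw [hK0, Subgroup.mem_bot] at hxK
      have : x = 1 := Subtype.ext hxK
      rw [this, ofMul_one, map_zero]
      exact zero_mem _
    · right
      have hKB := hmin K hKn (fun x hx => hx.1) hK0
      rw [eq_top_iff]
      intro v _
      obtain ⟨x, rfl⟩ := hsurjV v
      have hxK : (x : Q) ∈ K := by rw [hKB]; exact x.2
      exact hxK.2
  by_cases hnil : Group.IsNilpotent (Q ⧸ B)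
  · by_cases hcyc : IsCyclic (Q ⧸ B)
    · rw [← hcard]
      have hL0 : L ≠ ⊥ := by
        intro h
        apply hLn
        rw [h]
        infer_instance
      have hLc : ∀ a ∈ L, ∀ b ∈ L, a * b = b * a := by
        intro a ha b hb
        have h1 : ((a * b * a⁻¹ * b⁻¹ : Q) : Q ⧸ B) = 1 := by
          have hc : (a : Q ⧸ B) * b = b * a := IsMulCommutative.is_comm.comm _ _
          rw [QuotientGroup.mk_mul, QuotientGroup.mk_mul, QuotientGroup.mk_mul, hc]
          simp
        rw [QuotientGroup.eq_one_iff] at h1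
        have h2 : a * b * a⁻¹ * b⁻¹ ∈ B ⊓ L :=
          ⟨h1, mul_mem (mul_mem (mul_mem ha hb) (L.inv_mem ha)) (L.inv_mem hb)⟩
        rw [hinf, Subgroup.mem_bot] at h2
        rw [mul_inv_eq_one, mul_inv_eq_iff_eq_mul] at h2
        exact h2
      exact coveringNumber_le_of_commutative_complement hL0 hmin hcomm hsup hinf hcent hB0 hLc
    · have h1 := coveringNumber_le_card_of_nilpotent hnil hcyc ρ hρ
      have h2 := coveringNumber_le_of_surjective hcyc (QuotientGroup.mk' B)
        (QuotientGroup.mk'_surjective B)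
      rw [← hcard, ← hcardV]
      exact (h2.trans h1).trans (Nat.le_succ _)
  -- The preimage of M is a non-normal maximal subgroup of Q of index below |B| = |Q : L|.
  · obtain ⟨M, hM, hMn, hlt⟩ := exists_nonnormal_isCoatom_index_lt hnil ρ hρ hirr
    have hsurj := QuotientGroup.mk'_surjective B
    have h1 := hminidx (M.comap (QuotientGroup.mk' B)) ?_ ?_
    · rw [Subgroup.index_comap_of_surjective _ hsurj, ← hcard, ← hcardV] at h1
      exact absurd hlt (not_lt.mpr h1)
    · exact Subgroup.isCoatom_comap_of_surjective hsurj hM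
    · intro h
      apply hMn
      rw [← Subgroup.map_comap_eq_self_of_surjective hsurj M]
      exact h.map _ hsurj

/-! ### The bound σ ≤ |G : L| + 1 in general -/

theorem isCoatom_map_of_ker_le {G H : Type*} [Group G] [Group H] {f : G →* H}
    (hf : Function.Surjective f) {L : Subgroup G} (hL : IsCoatom L) (hker : f.ker ≤ L) :
    IsCoatom (L.map f) := by
  have hcm : (L.map f).comap f = L := by rw [Subgroup.comap_map_eq, sup_eq_left.mpr hker]
  refine ⟨fun h => hL.1 ?_, fun K hK => ?_⟩
  · rw [← hcm, h, Subgroup.comap_top]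
  · rw [← Subgroup.map_comap_eq_self_of_surjective hf K, hL.2 (K.comap f) ?_,
      Subgroup.map_top_of_surjective f hf]
    refine lt_of_le_of_ne ?_ fun h => hK.ne ?_
    · rw [← hcm]
      exact Subgroup.comap_mono hK.le
    · rw [h, Subgroup.map_comap_eq_self_of_surjective hf]

theorem normal_of_map_normal {G H : Type*} [Group G] [Group H] {f : G →* H} {L : Subgroup G}
    (hker : f.ker ≤ L) (h : (L.map f).Normal) : L.Normal := by
  have hcm : (L.map f).comap f = L := by rw [Subgroup.comap_map_eq, sup_eq_left.mpr hker]
  rw [← hcm]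
  infer_instance

/-- The covering number of a finite soluble group is at most `|G : L| + 1` for every non-normal
maximal subgroup `L`. -/
theorem coveringNumber_le_index_add_one {G : Type*} [Group G] [Finite G] [Group.IsSolvable G]
    {L : Subgroup G} (hL : IsCoatom L) (hLn : ¬ L.Normal) : coveringNumber G ≤ L.index + 1 := by
  -- It suffices to treat a non-normal maximal subgroup of least index, and this minimality survives
  -- in the quotient by its core.
  obtain ⟨M, ⟨hM, hMn⟩, hmin⟩ := Set.exists_min_image {M : Subgroup G | IsCoatom M ∧ ¬ M.Normal}
    (fun M => M.index) (Set.toFinite _) ⟨L, hL, hLn⟩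
  refine le_trans ?_ (Nat.add_le_add_right (hmin L ⟨hL, hLn⟩) 1)
  have hsurj := QuotientGroup.mk'_surjective M.normalCore
  have hker : (QuotientGroup.mk' M.normalCore).ker ≤ M := by
    rw [QuotientGroup.ker_mk']
    exact M.normalCore_le
  have hcm : (M.map (QuotientGroup.mk' M.normalCore)).comap (QuotientGroup.mk' M.normalCore) = M := by
    rw [Subgroup.comap_map_eq, sup_eq_left.mpr hker]
  have hM' := isCoatom_map_of_ker_le hsurj hM hker
  have hMn' : ¬ (M.map (QuotientGroup.mk' M.normalCore)).Normal :=
    fun h => hMn (normal_of_map_normal hker h)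
  have hidx : (M.map (QuotientGroup.mk' M.normalCore)).index = M.index := by
    rw [← Subgroup.index_comap_of_surjective _ hsurj, hcm]
  have hcyc : ¬ IsCyclic (G ⧸ M.normalCore) := fun h => hMn' inferInstance
  have hsol : Group.IsSolvable (G ⧸ M.normalCore) := inferInstance
  rw [← hidx]
  refine (coveringNumber_le_of_surjective hcyc _ hsurj).trans
    (coveringNumber_le_index_add_one_of_normalCore_eq_bot hM' hMn' ?_ ?_)
  · have h1 : (M.map (QuotientGroup.mk' M.normalCore)).normalCore.comap
        (QuotientGroup.mk' M.normalCore) ≤ M.normalCore := by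
      rw [Subgroup.normal_le_normalCore]
      calc _ ≤ (M.map (QuotientGroup.mk' M.normalCore)).comap _ :=
            Subgroup.comap_mono (Subgroup.normalCore_le _)
        _ = M := hcm
    rw [eq_bot_iff]
    intro q hq
    obtain ⟨g, rfl⟩ := QuotientGroup.mk_surjective q
    exact (QuotientGroup.eq_one_iff g).mpr (h1 hq)
  · intro K hK hKn
    have h2 := hmin (K.comap (QuotientGroup.mk' M.normalCore))
      ⟨Subgroup.isCoatom_comap_of_surjective hsurj hK, fun h => hKn ?_⟩
    · rw [Subgroup.index_comap_of_surjective _ hsurj] at h2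
      exact hidx.trans_le h2
    · rw [← Subgroup.map_comap_eq_self_of_surjective hsurj K]
      exact h.map _ hsurj

/-! ### Counting maximal subgroups by conjugacy class -/

/-- The set of conjugates of a subgroup. -/
def Subgroup.conjugates {G : Type*} [Group G] (L : Subgroup G) : Set (Subgroup G) :=
  Set.range fun g : G => L.map (MulAut.conj g).toMonoidHom

theorem Subgroup.mem_map_conj {G : Type*} [Group G] {L : Subgroup G} {g x : G} :
    x ∈ L.map (MulAut.conj g).toMonoidHom ↔ g⁻¹ * x * g ∈ L := by
  rw [Subgroup.mem_map]
  constructor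
  · rintro ⟨y, hy, rfl⟩
    simpa [mul_assoc] using hy
  · intro h
    exact ⟨_, h, by simp [mul_assoc]⟩

theorem isCoatom_of_mem_conjugates {G : Type*} [Group G] {L M : Subgroup G} (hL : IsCoatom L)
    (hM : M ∈ L.conjugates) : IsCoatom M := by
  obtain ⟨g, rfl⟩ := hM
  exact (OrderIso.isCoatom_iff (MulAut.conj g : G ≃* G).mapSubgroup L).mpr hL

theorem normal_of_normal_mem_conjugates {G : Type*} [Group G] {L M : Subgroup G}
    (hM : M ∈ L.conjugates) (h : M.Normal) : L.Normal := by
  obtain ⟨g, rfl⟩ := hM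
  refine ⟨fun x hx k => ?_⟩
  have h1 : g * x * g⁻¹ ∈ L.map (MulAut.conj g).toMonoidHom := ⟨x, hx, rfl⟩
  have h2 := h.conj_mem _ h1 (g * k * g⁻¹)
  rw [Subgroup.mem_map_conj] at h2
  convert h2 using 1
  group

theorem ncard_range_eq_index {G X : Type*} [Group G] {L : Subgroup G} (f : G → X)
    (hf : ∀ g h, f g = f h ↔ g⁻¹ * h ∈ L) : (Set.range f).ncard = L.index := by
  rw [← Nat.card_coe_set_eq]
  symm
  refine Nat.card_congr (Equiv.ofBijective (fun q : G ⧸ L => ⟨f q.out, q.out, rfl⟩) ⟨?_, ?_⟩)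
  · intro a b hab
    rw [← a.out_eq, ← b.out_eq]
    exact QuotientGroup.eq.mpr ((hf _ _).mp (congrArg Subtype.val hab))
  · rintro ⟨_, g, rfl⟩
    refine ⟨(g : G ⧸ L), Subtype.ext ?_⟩
    exact (hf _ _).mpr (QuotientGroup.eq.mp (g : G ⧸ L).out_eq)

/-- A non-normal maximal subgroup is its own normalizer. -/
theorem ncard_conjugates {G : Type*} [Group G] {L : Subgroup G} (hL : IsCoatom L)
    (hLn : ¬ L.Normal) : L.conjugates.ncard = L.index := by
  have hnorm : Subgroup.normalizer (L : Set G) = L := by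
    by_contra h
    exact hLn (Subgroup.normalizer_eq_top_iff.mp
      (hL.2 _ (lt_of_le_of_ne Subgroup.le_normalizer (Ne.symm h))))
  refine ncard_range_eq_index _ fun g h => ?_
  rw [← hnorm, Subgroup.mem_normalizer_iff]
  simp only [hnorm]
  constructor
  · intro hgh x
    have h1 : h * x * h⁻¹ ∈ L.map (MulAut.conj g).toMonoidHom ↔ x ∈ L := by
      rw [hgh, Subgroup.mem_map_conj]
      simp [mul_assoc]
    rw [← h1, Subgroup.mem_map_conj]
    simp [mul_assoc]
  · intro hn
    ext x
    rw [Subgroup.mem_map_conj, Subgroup.mem_map_conj, hn (h⁻¹ * x * h)]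
    simp [mul_assoc]

theorem numMaximalSubgroups_eq_ncard (G : Type*) [Group G] :
    numMaximalSubgroups G = {M : Subgroup G | IsCoatom M}.ncard :=
  Nat.card_coe_set_eq _

theorem disjoint_normal_conjugates {G : Type*} [Group G] {L : Subgroup G} (hLn : ¬ L.Normal) :
    Disjoint {M : Subgroup G | IsCoatom M ∧ M.Normal} L.conjugates :=
  Set.disjoint_left.mpr fun _ h1 h2 => hLn (normal_of_normal_mem_conjugates h2 h1.2)

theorem ncard_normal_add_index_le {G : Type*} [Group G] [Finite G] {L : Subgroup G}
    (hL : IsCoatom L) (hLn : ¬ L.Normal) :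
    {M : Subgroup G | IsCoatom M ∧ M.Normal}.ncard + L.index ≤ numMaximalSubgroups G := by
  rw [numMaximalSubgroups_eq_ncard, ← ncard_conjugates hL hLn,
    ← Set.ncard_union_eq (disjoint_normal_conjugates hLn)]
  refine Set.ncard_le_ncard ?_
  rintro M (h | h)
  · exact h.1
  · exact isCoatom_of_mem_conjugates hL h

theorem numMaximalSubgroups_eq_of_unique {G : Type*} [Group G] [Finite G] {L : Subgroup G}
    (hL : IsCoatom L) (hLn : ¬ L.Normal)
    (h : ∀ M : Subgroup G, IsCoatom M → ¬ M.Normal → M ∈ L.conjugates) :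
    numMaximalSubgroups G = {M : Subgroup G | IsCoatom M ∧ M.Normal}.ncard + L.index := by
  refine le_antisymm ?_ (ncard_normal_add_index_le hL hLn)
  rw [numMaximalSubgroups_eq_ncard, ← ncard_conjugates hL hLn,
    ← Set.ncard_union_eq (disjoint_normal_conjugates hLn)]
  refine Set.ncard_le_ncard fun M hM => ?_
  by_cases hMn : M.Normal
  · exact Or.inl ⟨hM, hMn⟩
  · exact Or.inr (h M hM hMn)

theorem ncard_normal_add_index_add_index_le {G : Type*} [Group G] [Finite G] {L K : Subgroup G}
    (hL : IsCoatom L) (hLn : ¬ L.Normal) (hK : IsCoatom K) (hKn : ¬ K.Normal)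
    (hKL : K ∉ L.conjugates) :
    {M : Subgroup G | IsCoatom M ∧ M.Normal}.ncard + L.index + K.index ≤
      numMaximalSubgroups G := by
  have hd : Disjoint ({M : Subgroup G | IsCoatom M ∧ M.Normal} ∪ L.conjugates) K.conjugates := by
    rw [Set.disjoint_union_left]
    refine ⟨disjoint_normal_conjugates hKn, Set.disjoint_left.mpr ?_⟩
    rintro _ ⟨g, rfl⟩ ⟨h, hh⟩
    refine hKL ⟨h⁻¹ * g, ?_⟩
    ext x
    have hh' : K.map (MulAut.conj h).toMonoidHom = L.map (MulAut.conj g).toMonoidHom := hh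
    have h1 : h * x * h⁻¹ ∈ K.map (MulAut.conj h).toMonoidHom ↔ x ∈ K := by
      rw [Subgroup.mem_map_conj]
      simp [mul_assoc]
    rw [← h1, hh', Subgroup.mem_map_conj, Subgroup.mem_map_conj]
    simp [mul_assoc]
  rw [numMaximalSubgroups_eq_ncard, ← ncard_conjugates hL hLn, ← ncard_conjugates hK hKn,
    ← Set.ncard_union_eq (disjoint_normal_conjugates hLn), ← Set.ncard_union_eq hd]
  refine Set.ncard_le_ncard ?_
  rintro M ((h | h) | h)
  · exact h.1
  · exact isCoatom_of_mem_conjugates hL h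
  · exact isCoatom_of_mem_conjugates hK h

theorem exists_normal_isCoatom_of_ne_top {G : Type*} [Group G] [Finite G] {K : Subgroup G}
    (h : K ⊔ commutator G ≠ ⊤) : ∃ M : Subgroup G, IsCoatom M ∧ M.Normal ∧ K ≤ M := by
  obtain ⟨M, hM, hle⟩ := (eq_top_or_exists_le_coatom _).resolve_left h
  exact ⟨M, hM, Subgroup.Normal.of_commutator_le G (le_sup_right.trans hle), le_sup_left.trans hle⟩

theorem ncard_normal_isCoatom_pos {G : Type*} [Group G] [Finite G] [Group.IsSolvable G]
    [Nontrivial G] : 0 < {M : Subgroup G | IsCoatom M ∧ M.Normal}.ncard := by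
  have h := (Group.IsSolvable.commutator_lt_top_of_nontrivial G).ne
  obtain ⟨M, hM, hMn, -⟩ := exists_normal_isCoatom_of_ne_top (K := (⊥ : Subgroup G))
    (by rwa [bot_sup_eq])
  exact (Set.ncard_pos).mpr ⟨M, hM, hMn⟩

/-- If no element generates `G` modulo its commutator subgroup then the normal maximal subgroups
cover `G`. -/
theorem coveringNumber_le_ncard_normal {G : Type*} [Group G] [Finite G]
    (h : ∀ x : G, Subgroup.zpowers x ⊔ commutator G ≠ ⊤) :
    coveringNumber G ≤ {M : Subgroup G | IsCoatom M ∧ M.Normal}.ncard := by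
  rw [← Nat.card_coe_set_eq]
  refine coveringNumber_le_card
    (fun M : {M : Subgroup G | IsCoatom M ∧ M.Normal} => (M : Subgroup G)) (fun M => M.2.1.1) ?_
  intro g
  obtain ⟨M, hM, hMn, hle⟩ := exists_normal_isCoatom_of_ne_top (h g)
  exact ⟨⟨M, hM, hMn⟩, hle (Subgroup.mem_zpowers g)⟩

/-- A finite soluble group with fewer than `2σ - 1` maximal subgroups has cyclic abelianization and
at most one conjugacy class of non-normal maximal subgroups. -/
theorem cyclic_and_unique_of_numMaximalSubgroups_lt {G : Type*} [Group G] [Finite G]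
    [Group.IsSolvable G] (hm : (numMaximalSubgroups G : ℤ) < 2 * (coveringNumber G : ℤ) - 1)
    {L : Subgroup G} (hL : IsCoatom L) (hLn : ¬ L.Normal) :
    (∃ x : G, Subgroup.zpowers x ⊔ commutator G = ⊤) ∧
      ∀ M : Subgroup G, IsCoatom M → ¬ M.Normal → M ∈ L.conjugates := by
  have h1 := coveringNumber_le_index_add_one hL hLn
  constructor
  -- Normal maximal subgroups now number at least σ, and the conjugates of L at least σ - 1.
  · by_contra! h
    have h2 := coveringNumber_le_ncard_normal h
    have h3 := ncard_normal_add_index_le hL hLn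
    omega
  -- Two classes contribute 2(σ - 1), and solubility supplies one normal maximal subgroup more.
  · intro M hM hMn
    by_contra h
    have h2 := coveringNumber_le_index_add_one hM hMn
    have h3 := ncard_normal_add_index_add_index_le hL hLn hM hMn h
    have hnt : Nontrivial G := by
      by_contra hn
      rw [not_nontrivial_iff_subsingleton] at hn
      exact hL.1 (Subsingleton.elim _ _)
    have h4 := ncard_normal_isCoatom_pos (G := G)
    omega

theorem le_of_le_mem_conjugates {G : Type*} [Group G] {K L M : Subgroup G} [hK : K.Normal]
    (hM : M ∈ L.conjugates) (h : K ≤ M) : K ≤ L := by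
  obtain ⟨g, rfl⟩ := hM
  intro k hk
  have h1 := h (hK.conj_mem k hk g)
  rw [Subgroup.mem_map_conj] at h1
  simpa [mul_assoc] using h1

theorem le_mem_conjugates {G : Type*} [Group G] {K L M : Subgroup G} [hK : K.Normal]
    (hM : M ∈ L.conjugates) (h : K ≤ L) : K ≤ M := by
  obtain ⟨g, rfl⟩ := hM
  intro k hk
  rw [Subgroup.mem_map_conj]
  simpa using h (hK.conj_mem k hk g⁻¹)

/-! ### Structure of groups with one class of non-normal maximal subgroups -/

/-- The finite groups with trivial Frattini subgroup and with cyclic abelianization, generated by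
the image of `x`, whose non-normal maximal subgroups are the conjugates of `L`. -/
structure IsUniqueNonnormalMaximal {G : Type*} [Group G] (L : Subgroup G) (x : G) : Prop where
  isCoatom : IsCoatom L
  not_normal : ¬ L.Normal
  mem_conjugates : ∀ M : Subgroup G, IsCoatom M → ¬ M.Normal → M ∈ L.conjugates
  generates : Subgroup.zpowers x ⊔ commutator G = ⊤
  frattini_eq_bot : frattini G = ⊥

namespace IsUniqueNonnormalMaximal

variable {G : Type*} [Group G] {L : Subgroup G} {x : G}

/-- A normal K outside L lies in no conjugate of L, and a normal maximal subgroup containing x and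
G' would be G. So K and x generate G, and G/K is cyclic. -/
theorem commutator_le [Finite G] (h : IsUniqueNonnormalMaximal L x) {K : Subgroup G}
    [hK : K.Normal] (hKL : ¬ K ≤ L) : commutator G ≤ K := by
  have hs : K ⊔ Subgroup.zpowers x = ⊤ := by
    by_contra hs
    obtain ⟨M, hM, hle⟩ := (eq_top_or_exists_le_coatom _).resolve_left hs
    by_cases hMn : M.Normal
    · apply hM.1
      rw [eq_top_iff, ← h.generates]
      exact sup_le (le_sup_right.trans hle) (commutator_le_of_isCoatom hM)
    · exact hKL (le_of_le_mem_conjugates (h.mem_conjugates M hM hMn) (le_sup_left.trans hle))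
  exact Subgroup.Normal.commutator_le_of_self_sup_commutative_eq_top hs inferInstance

theorem not_commutator_le (h : IsUniqueNonnormalMaximal L x) : ¬ commutator G ≤ L :=
  fun hle => h.not_normal (Subgroup.Normal.of_commutator_le G hle)

/-- Normal maximal subgroups contain G', the others are conjugates of L and contain its core; the
intersection therefore lies in Φ = 1. -/
theorem normalCore_inf_commutator (h : IsUniqueNonnormalMaximal L x) :
    L.normalCore ⊓ commutator G = ⊥ := by
  rw [eq_bot_iff, ← h.frattini_eq_bot]
  refine le_iInf₂ fun M hM => ?_
  by_cases hMn : M.Normal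
  · exact inf_le_right.trans (commutator_le_of_isCoatom hM)
  · exact inf_le_left.trans (le_mem_conjugates (h.mem_conjugates M hM hMn) L.normalCore_le)

theorem eq_bot_of_normal_of_le (h : IsUniqueNonnormalMaximal L x) {K : Subgroup G}
    (hK : K.Normal) (h1 : K ≤ L) (h2 : K ≤ commutator G) : K = ⊥ := by
  rw [eq_bot_iff, ← h.normalCore_inf_commutator]
  exact le_inf (Subgroup.normal_le_normalCore.mpr h1) h2

open scoped commutatorElement in
theorem normalCore_central (h : IsUniqueNonnormalMaximal L x) {z : G} (hz : z ∈ L.normalCore)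
    (g : G) : z * g = g * z := by
  have hc : ⁅z, g⁆ ∈ L.normalCore ⊓ commutator G :=
    ⟨Subgroup.commutator_le_left _ _ (Subgroup.commutator_mem_commutator hz (Subgroup.mem_top g)),
      Subgroup.commutator_mem_commutator (Subgroup.mem_top z) (Subgroup.mem_top g)⟩
  rw [h.normalCore_inf_commutator, Subgroup.mem_bot] at hc
  exact commutatorElement_eq_one_iff_mul_comm.mp hc

theorem commutator_minimal [Finite G] (h : IsUniqueNonnormalMaximal L x) (K : Subgroup G)
    (hK : K.Normal) (hle : K ≤ commutator G) (h0 : K ≠ ⊥) : K = commutator G :=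
  le_antisymm hle (h.commutator_le fun hKL => h0 (h.eq_bot_of_normal_of_le hK hKL hle))

theorem commutator_sup (h : IsUniqueNonnormalMaximal L x) : commutator G ⊔ L = ⊤ := by
  rw [sup_comm]
  exact h.isCoatom.2 _ (left_lt_sup.mpr h.not_commutator_le)

theorem commutator_ne_bot (h : IsUniqueNonnormalMaximal L x) : commutator G ≠ ⊥ := fun h0 =>
  h.not_commutator_le (h0 ▸ bot_le)

theorem commutator_comm [Finite G] [Group.IsSolvable G] (h : IsUniqueNonnormalMaximal L x) :
    ∀ a ∈ commutator G, ∀ b ∈ commutator G, a * b = b * a := fun _ ha _ hb =>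
  commute_of_commutator_self_eq_bot
    (commutator_self_eq_bot_of_minimal_normal h.commutator_ne_bot h.commutator_minimal) ha hb

theorem commutator_inf [Finite G] [Group.IsSolvable G] (h : IsUniqueNonnormalMaximal L x) :
    commutator G ⊓ L = ⊥ := by
  refine h.eq_bot_of_normal_of_le (normal_of_sup_eq_top_of_le_normalizer
    h.commutator_sup ?_ ?_) inf_le_right inf_le_left
  · rintro b hb y ⟨hy, hyL⟩
    rw [h.commutator_comm b hb y hy, mul_inv_cancel_right]
    exact ⟨hy, hyL⟩
  · rintro l hl y ⟨hy, hyL⟩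
    exact ⟨(inferInstance : (commutator G).Normal).conj_mem y hy l,
      mul_mem (mul_mem hl hyL) (L.inv_mem hl)⟩

/-- The centralizer of G' in L is normalized by both G' and L, so it is a normal subgroup inside L.
-/
theorem mem_normalCore (h : IsUniqueNonnormalMaximal L x) {l : G} (hl : l ∈ L)
    (hc : ∀ b ∈ commutator G, l * b = b * l) : l ∈ L.normalCore := by
  have hn : (L ⊓ Subgroup.centralizer (commutator G : Set G)).Normal := by
    refine normal_of_sup_eq_top_of_le_normalizer h.commutator_sup ?_ ?_
    · rintro b hb y ⟨hyL, hy⟩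
      rw [Subgroup.mem_centralizer_iff.mp hy b hb, mul_inv_cancel_right]
      exact ⟨hyL, hy⟩
    · rintro k hk y ⟨hyL, hy⟩
      exact ⟨mul_mem (mul_mem hk hyL) (L.inv_mem hk),
        (inferInstance : (Subgroup.centralizer (commutator G : Set G)).Normal).conj_mem y hy k⟩
  exact Subgroup.normal_le_normalCore.mpr inf_le_left
    (show l ∈ L ⊓ Subgroup.centralizer (commutator G : Set G) from
      ⟨hl, Subgroup.mem_centralizer_iff.mpr fun b hb => (hc b hb).symm⟩)

theorem isCyclic_quotient (h : IsUniqueNonnormalMaximal L x) : IsCyclic (G ⧸ commutator G) := by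
  refine ⟨(x : G ⧸ commutator G), fun y => ?_⟩
  obtain ⟨g, rfl⟩ := QuotientGroup.mk_surjective y
  have hg : g ∈ Subgroup.zpowers x ⊔ commutator G := h.generates ▸ Subgroup.mem_top g
  obtain ⟨_, ⟨k, rfl⟩, c, hc, rfl⟩ := Subgroup.mem_sup_of_normal_right.mp hg
  refine ⟨k, ?_⟩
  simp [(QuotientGroup.eq_one_iff c).mpr hc]

theorem card_commutator [Finite G] [Group.IsSolvable G] (h : IsUniqueNonnormalMaximal L x) :
    Nat.card (commutator G) = L.index :=
  card_eq_index_of_normal_complement h.commutator_sup h.commutator_inf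

theorem card_quotient [Finite G] [Group.IsSolvable G] (h : IsUniqueNonnormalMaximal L x) :
    Nat.card (G ⧸ commutator G) = Nat.card L := by
  have h1 := Subgroup.card_eq_card_quotient_mul_card_subgroup (commutator G)
  have h2 := L.card_mul_index
  rw [h.card_commutator, ← h2] at h1
  exact (Nat.eq_of_mul_eq_mul_right (Nat.pos_of_ne_zero Subgroup.index_ne_zero_of_finite) h1).symm

theorem isCyclic [Finite G] [Group.IsSolvable G] (h : IsUniqueNonnormalMaximal L x) :
    IsCyclic L := by
  have := h.isCyclic_quotient
  refine isCyclic_of_injective ((QuotientGroup.mk' (commutator G)).comp L.subtype) ?_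
  rw [injective_iff_map_eq_one]
  intro l hl
  have h1 : (l : G) ∈ commutator G ⊓ L := ⟨(QuotientGroup.eq_one_iff _).mp hl, l.2⟩
  rw [h.commutator_inf, Subgroup.mem_bot] at h1
  exact Subtype.ext h1

/-- Every cover by proper subgroups has a member for each element of `G'`, since these members are
contained in different conjugates of `L`, and one more for the elements of `G'`. -/
theorem index_lt_coveringNumber [Finite G] [Group.IsSolvable G]
    (h : IsUniqueNonnormalMaximal L x) : L.index < coveringNumber G := by
  have hcyc : ¬ IsCyclic G := fun _ => h.not_normal inferInstance
  obtain ⟨H, hH, hcov⟩ := exists_cover hcyc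
  -- A normal maximal subgroup over H i would contain G' and e x, hence x, and be everything. So H i
  -- lies in a conjugate of L, which meets G' trivially.
  have hkey : ∀ e : commutator G, ∃ i, (e : G) * x ∈ H i ∧ H i ⊓ commutator G = ⊥ := by
    intro e
    obtain ⟨i, hi⟩ := hcov (e * x)
    refine ⟨i, hi, ?_⟩
    obtain ⟨M, hM, hle⟩ := (eq_top_or_exists_le_coatom _).resolve_left (hH i)
    have hMn : ¬ M.Normal := by
      intro hMn
      have h1 := commutator_le_of_isCoatom hM
      have h2 : x ∈ M := by
        have := mul_mem (M.inv_mem (h1 e.2)) (hle hi)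
        rwa [inv_mul_cancel_left] at this
      apply hM.1
      rw [eq_top_iff, ← h.generates]
      exact sup_le (Subgroup.zpowers_le.mpr h2) h1
    obtain ⟨g, rfl⟩ := h.mem_conjugates M hM hMn
    rw [eq_bot_iff]
    rintro y ⟨hy, hyc⟩
    have h3 : g⁻¹ * y * g ∈ commutator G ⊓ L := by
      refine ⟨?_, Subgroup.mem_map_conj.mp (hle hy)⟩
      simpa using (inferInstance : (commutator G).Normal).conj_mem y hyc g⁻¹
    rw [h.commutator_inf, Subgroup.mem_bot] at h3
    rw [Subgroup.mem_bot]
    have h4 : y = g * (g⁻¹ * y * g) * g⁻¹ := by group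
    rw [h4, h3, mul_one, mul_inv_cancel]
  choose i hi hbot using hkey
  obtain ⟨e₀, he₀, hne⟩ :=
    (Subgroup.bot_or_exists_ne_one _).resolve_left h.commutator_ne_bot
  obtain ⟨i₀, hi₀⟩ := hcov e₀
  -- The extra point of `Option` indexes a member containing a nontrivial element of G', which none
  -- of the other members does.
  have hle : Nat.card (Option (commutator G)) ≤ Nat.card (Fin (coveringNumber G)) := by
    refine Nat.card_le_card_of_injective (fun o => o.elim i₀ i) ?_
    have hi₀' : ∀ e, i₀ ≠ i e := by
      intro e he
      have : e₀ ∈ H (i e) ⊓ commutator G := ⟨he ▸ hi₀, he₀⟩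
      rw [hbot, Subgroup.mem_bot] at this
      exact hne this
    rintro (_ | a) (_ | b) hab
    · rfl
    · exact absurd hab (hi₀' b)
    · exact absurd hab.symm (hi₀' a)
    · have hab : i a = i b := hab
      have h1 : (a : G) * (b : G)⁻¹ ∈ H (i a) ⊓ commutator G := by
        refine ⟨?_, mul_mem a.2 ((commutator G).inv_mem b.2)⟩
        have := mul_mem (hi a) ((H (i a)).inv_mem (hab ▸ hi b))
        simpa [mul_assoc] using this
      rw [hbot, Subgroup.mem_bot, mul_inv_eq_one] at h1
      rw [Subtype.ext h1]
  rw [Finite.card_option, h.card_commutator, Nat.card_fin] at hle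
  exact hle

/-- The primes dividing the order of the core of `L` divide the order of `L` only once. -/
theorem not_sq_dvd_card [Finite G] [Group.IsSolvable G] (h : IsUniqueNonnormalMaximal L x)
    {p : ℕ} (hp : p.Prime) (hdvd : p ∣ Nat.card L.normalCore) : ¬ p ^ 2 ∣ Nat.card L := by
  rintro ⟨m, hm⟩
  have : Fact p.Prime := ⟨hp⟩
  obtain ⟨z, hz⟩ := exists_prime_orderOf_dvd_card' p hdvd
  have hzp : (z : G) ^ p = 1 := by
    rw [← Subgroup.coe_pow, ← hz, pow_orderOf_eq_one, Subgroup.coe_one]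
  have hLc := h.isCyclic
  obtain ⟨y, hy⟩ := IsCyclic.exists_generator (α := L)
  have hyo : orderOf y = Nat.card L := orderOf_eq_card_of_forall_mem_zpowers hy
  obtain ⟨k, hk⟩ := hy ⟨z, L.normalCore_le z.2⟩
  have hk : y ^ k = ⟨z, L.normalCore_le z.2⟩ := hk
  have hzk : (z : G) = (y : G) ^ k := by
    rw [← Subgroup.coe_zpow, hk]
  have hpk : (p : ℤ) ∣ k := by
    have h1 : y ^ (k * p) = 1 := by
      rw [zpow_mul, hk, zpow_natCast]
      exact Subtype.ext hzp
    rw [← orderOf_dvd_iff_zpow_eq_one, hyo, hm] at h1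
    have h2 : (p : ℤ) * (p * m) ∣ p * k := by
      rw [mul_comm (p : ℤ) k]
      refine dvd_trans (dvd_of_eq ?_) h1
      push_cast
      ring
    exact (dvd_mul_right _ _).trans
      ((mul_dvd_mul_iff_left (by exact_mod_cast hp.ne_zero : (p : ℤ) ≠ 0)).mp h2)
  -- As p divides k, z is a p-th power and lies in each normal maximal subgroup of index p; Bézout
  -- handles other prime indices, and conjugates of L contain the core.
  have hzf : (z : G) ∈ frattini G := by
    refine (Subgroup.mem_iInf.mpr fun M => Subgroup.mem_iInf.mpr fun hM => ?_ :
      (z : G) ∈ ⨅ (M : Subgroup G) (_ : IsCoatom M), M)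
    by_cases hMn : M.Normal
    · have hpr := index_prime_of_isCoatom hM
      by_cases hMp : M.index = p
      · obtain ⟨j, rfl⟩ := hpk
        rw [hzk, zpow_mul, zpow_natCast, ← hMp]
        exact Subgroup.zpow_mem _ (M.pow_index_mem _) _
      · have hcop : Nat.Coprime M.index p := (Nat.coprime_primes hpr hp).mpr hMp
        have h1 : (z : G) ^ M.index ∈ M := M.pow_index_mem _
        have h2 : (z : G) ^ p ∈ M := hzp ▸ one_mem M
        have h3 : (z : G) ^ (Nat.gcdA M.index p * M.index + Nat.gcdB M.index p * p : ℤ) = z := by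
          have := Nat.gcd_eq_gcd_ab M.index p
          rw [hcop.gcd_eq_one] at this
          rw [mul_comm, mul_comm _ (p : ℤ), ← this]
          simp
        rw [← h3, zpow_add, mul_comm, zpow_mul, mul_comm _ (p : ℤ), zpow_mul, zpow_natCast,
          zpow_natCast]
        exact mul_mem (Subgroup.zpow_mem _ h1 _) (Subgroup.zpow_mem _ h2 _)
    · exact le_mem_conjugates (h.mem_conjugates M hM hMn) L.normalCore_le z.2
  rw [h.frattini_eq_bot, Subgroup.mem_bot] at hzf
  have : z = 1 := Subtype.ext hzf
  rw [this, orderOf_one] at hz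
  exact hp.one_lt.ne hz

end IsUniqueNonnormalMaximal

/-! ### Maximal subgroups of cyclic groups and quotients; explicit models -/

theorem isCoatom_of_index_prime {G : Type*} [Group G] [Finite G] {M : Subgroup G}
    (h : M.index.Prime) : IsCoatom M := by
  refine ⟨fun ht => ?_, fun K hK => ?_⟩
  · rw [ht, Subgroup.index_top] at h
    exact Nat.not_prime_one h
  · have h1 := Subgroup.relIndex_mul_index hK.le
    rcases (Nat.dvd_prime h).mp ⟨_, (mul_comm _ _).trans h1 |>.symm⟩ with h2 | h2
    · exact Subgroup.index_eq_one.mp h2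
    · rw [h2] at h1
      have h3 : M.relIndex K = 1 := Nat.eq_of_mul_eq_mul_right h.pos (by rw [h1, one_mul])
      exact absurd (Subgroup.relIndex_eq_one.mp h3) (not_le_of_gt hK)

theorem index_zpowers_pow {C : Type*} [Group C] [Finite C] {y : C}
    (hy : ∀ c, c ∈ Subgroup.zpowers y) {d : ℕ} (hd : d ∣ Nat.card C) :
    (Subgroup.zpowers (y ^ d)).index = d := by
  have hd0 : 0 < d := Nat.pos_of_dvd_of_pos hd Nat.card_pos
  have h1 := (Subgroup.zpowers (y ^ d)).card_mul_index
  have h2 : Nat.card (Subgroup.zpowers (y ^ d)) = Nat.card C / d := by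
    rw [Nat.card_zpowers, orderOf_pow_of_dvd hd0.ne', orderOf_eq_card_of_forall_mem_zpowers hy]
    rwa [orderOf_eq_card_of_forall_mem_zpowers hy]
  rw [h2] at h1
  have h3 : 0 < Nat.card C / d := Nat.div_pos (Nat.le_of_dvd Nat.card_pos hd) hd0
  exact Nat.eq_of_mul_eq_mul_left h3 (by rw [h1, Nat.div_mul_cancel hd])

theorem numMaximalSubgroups_of_isCyclic (C : Type*) [Group C] [Finite C] [IsCyclic C] :
    numMaximalSubgroups C = (Nat.card C).primeFactors.card := by
  obtain ⟨y, hy⟩ := IsCyclic.exists_generator (α := C)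
  rw [numMaximalSubgroups_eq_ncard, ← Set.ncard_coe_finset]
  have himg : {M : Subgroup C | IsCoatom M} =
      (fun p : ℕ => Subgroup.zpowers (y ^ p)) '' ((Nat.card C).primeFactors : Set ℕ) := by
    ext M
    constructor
    · intro hM
      refine ⟨M.index, ?_, ?_⟩
      · exact Nat.mem_primeFactors.mpr
          ⟨index_prime_of_isCoatom hM, M.index_dvd_card, Nat.card_pos.ne'⟩
      · have hle : Subgroup.zpowers (y ^ M.index) ≤ M :=
          Subgroup.zpowers_le.mpr (M.pow_index_mem y)
        refine Subgroup.eq_of_le_of_card_ge hle (le_of_eq ?_)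
        have h1 := M.card_mul_index
        rw [← (Subgroup.zpowers (y ^ M.index)).card_mul_index,
          index_zpowers_pow hy M.index_dvd_card] at h1
        exact Nat.eq_of_mul_eq_mul_right
          (Nat.pos_of_ne_zero Subgroup.index_ne_zero_of_finite) h1
    · rintro ⟨p, hp, rfl⟩
      have hp := Nat.mem_primeFactors.mp hp
      exact isCoatom_of_index_prime (by rw [index_zpowers_pow hy hp.2.1]; exact hp.1)
  rw [himg, Set.InjOn.ncard_image]
  intro p hp r hr hpr
  rw [← index_zpowers_pow hy (Nat.mem_primeFactors.mp hp).2.1,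
    ← index_zpowers_pow hy (Nat.mem_primeFactors.mp hr).2.1]
  exact congrArg Subgroup.index hpr

theorem numMaximalSubgroups_cyclicGroupZ {t : ℕ} (ht : t ≠ 0) :
    numMaximalSubgroups (CyclicGroupZ t) = t.primeFactors.card := by
  have : NeZero t := ⟨ht⟩
  have hf : Finite (CyclicGroupZ t) := inferInstanceAs (Finite (ZMod t))
  rw [numMaximalSubgroups_of_isCyclic, show Nat.card (CyclicGroupZ t) = t from Nat.card_zmod t]

/-- The maximal subgroups of a quotient are the maximal subgroups containing the kernel. -/
theorem ncard_isCoatom_ker_le {G H : Type*} [Group G] [Group H] {f : G →* H}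
    (hf : Function.Surjective f) :
    {M : Subgroup G | IsCoatom M ∧ f.ker ≤ M}.ncard = numMaximalSubgroups H := by
  rw [numMaximalSubgroups_eq_ncard,
    ← Set.ncard_image_of_injective _ (Subgroup.comap_injective hf)]
  congr 1
  ext M
  constructor
  · rintro ⟨hM, hle⟩
    exact ⟨M.map f, isCoatom_map_of_ker_le hf hM hle, by
      rw [Subgroup.comap_map_eq, sup_eq_left.mpr hle]⟩
  · rintro ⟨K, hK, rfl⟩
    exact ⟨Subgroup.isCoatom_comap_of_surjective hf hK, MonoidHom.ker_le_comap f K⟩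

/-- A maximal subgroup is normal exactly when it contains G'. -/
theorem ncard_normal_isCoatom (G : Type*) [Group G] [Finite G] :
    {M : Subgroup G | IsCoatom M ∧ M.Normal}.ncard = numMaximalSubgroups (G ⧸ commutator G) := by
  rw [← ncard_isCoatom_ker_le (QuotientGroup.mk'_surjective (commutator G)),
    QuotientGroup.ker_mk']
  congr 1
  ext M
  exact and_congr_right fun hM => ⟨fun _ => commutator_le_of_isCoatom hM,
    fun h => Subgroup.Normal.of_commutator_le G h⟩

theorem exists_mulEquiv_cyclicGroupZ {C : Type*} [Group C] [h : IsCyclic C] {m : ℕ}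
    (hm : Nat.card C = m) : Nonempty (CyclicGroupZ m ≃* C) := by
  subst hm
  exact ⟨zmodCyclicMulEquiv h⟩

theorem exists_mulEquiv_elementaryAbelian {B : Type*} [Group B] [Finite B] {q : ℕ}
    (hq : q.Prime) (hcomm : ∀ a b : B, a * b = b * a) (hpow : ∀ x : B, x ^ q = 1) :
    ∃ k : ℕ, Nonempty (ElementaryAbelian q k ≃* B) := by
  have : Fact q.Prime := ⟨hq⟩
  obtain ⟨V, _, _, ⟨e⟩⟩ : ∃ (V : Type _) (_ : AddCommGroup V) (_ : Module (ZMod q) V),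
      Nonempty (Additive B ≃+ V) :=
    let i₁ : AddCommGroup (Additive B) := { (inferInstance : AddGroup (Additive B)) with
      add_comm := hcomm }
    ⟨Additive B, i₁, AddCommGroup.zmodModule hpow, ⟨AddEquiv.refl _⟩⟩
  have hfin : Finite V := Finite.of_equiv _ e.toEquiv
  exact ⟨_, ⟨AddEquiv.toMultiplicativeLeft
    ((Module.finBasis (ZMod q) V).equivFun.symm.toAddEquiv.trans e.symm)⟩⟩

theorem card_elementaryAbelian {q : ℕ} (hq : q.Prime) (k : ℕ) :
    Nat.card (ElementaryAbelian q k) = q ^ k := by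
  have : Fact q.Prime := ⟨hq⟩
  calc Nat.card (ElementaryAbelian q k) = Nat.card (Fin k → ZMod q) := rfl
    _ = q ^ k := by simp

/-- An internal decomposition `G = (E ⋊ T) × N`. -/
theorem exists_mulEquiv_semidirectProduct_prod {G : Type*} [Group G] [Finite G]
    {E T N L : Subgroup G} [E.Normal] (hinf : E ⊓ L = ⊥) (hTL : T ≤ L) (hNL : N ≤ L)
    (hTN : T ⊓ N = ⊥) (hN : ∀ z ∈ N, ∀ g : G, g * z = z * g)
    (hcard : Nat.card E * Nat.card T * Nat.card N = Nat.card G) :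
    Nonempty (G ≃* (E ⋊[(MulAut.conjNormal : G →* MulAut E).comp T.subtype] T) × N) := by
  let f : (E ⋊[(MulAut.conjNormal : G →* MulAut E).comp T.subtype] T) →* G :=
    SemidirectProduct.lift E.subtype T.subtype (fun g => by
      ext e
      simp [MulAut.conjNormal_apply])
  let F : (E ⋊[(MulAut.conjNormal : G →* MulAut E).comp T.subtype] T) × N →* G :=
    MonoidHom.noncommCoprod f N.subtype fun m n => hN n n.2 (f m)
  have hF : Function.Injective F := by
    rw [injective_iff_map_eq_one]
    rintro ⟨⟨e, t⟩, n⟩ h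
    have h : (e : G) * t * n = 1 := h
    have he : (e : G) ∈ E ⊓ L := by
      refine ⟨e.2, ?_⟩
      rw [mul_assoc, mul_eq_one_iff_eq_inv] at h
      rw [h]
      exact L.inv_mem (mul_mem (hTL t.2) (hNL n.2))
    rw [hinf, Subgroup.mem_bot] at he
    rw [he, one_mul, mul_eq_one_iff_eq_inv] at h
    have ht : (t : G) ∈ T ⊓ N := ⟨t.2, by rw [h]; exact N.inv_mem n.2⟩
    rw [hTN, Subgroup.mem_bot] at ht
    rw [ht, eq_comm, inv_eq_one] at h
    rw [show e = 1 from Subtype.ext he, show t = 1 from Subtype.ext ht,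
      show n = 1 from Subtype.ext h]
    rfl
  have hE : Finite ((E ⋊[(MulAut.conjNormal : G →* MulAut E).comp T.subtype] T) × N) :=
    Finite.of_injective F hF
  have hb : Function.Bijective F := by
    refine (Nat.bijective_iff_injective_and_card F).mpr ⟨hF, ?_⟩
    rw [Nat.card_prod, SemidirectProduct.card, hcard]
  exact ⟨(MulEquiv.ofBijective F hb).symm⟩

theorem prod_equivFin_primeFactors {n : ℕ} (hn : Squarefree n) :
    ∏ i : Fin n.primeFactors.card, ((n.primeFactors.equivFin.symm i : n.primeFactors) : ℕ) = n := by
  rw [Equiv.prod_comp n.primeFactors.equivFin.symm (fun p => (p : ℕ)),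
    Finset.prod_coe_sort n.primeFactors (fun p => p)]
  exact Nat.prod_primeFactors_of_squarefree hn

/-! ### Exact values of σ and m, and the direct decomposition -/

namespace IsUniqueNonnormalMaximal

variable {G : Type*} [Group G] {L : Subgroup G} {x : G}

theorem coveringNumber_eq [Finite G] [Group.IsSolvable G] (h : IsUniqueNonnormalMaximal L x) :
    coveringNumber G = L.index + 1 :=
  le_antisymm (coveringNumber_le_index_add_one h.isCoatom h.not_normal) h.index_lt_coveringNumber

theorem numMaximalSubgroups_eq [Finite G] [Group.IsSolvable G]
    (h : IsUniqueNonnormalMaximal L x) :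
    numMaximalSubgroups G = (Nat.card L).primeFactors.card + L.index := by
  have := h.isCyclic_quotient
  rw [numMaximalSubgroups_eq_of_unique h.isCoatom h.not_normal h.mem_conjugates,
    ncard_normal_isCoatom, numMaximalSubgroups_of_isCyclic, h.card_quotient]

theorem index_ne_two [Finite G] [Group.IsSolvable G] (h : IsUniqueNonnormalMaximal L x) :
    L.index ≠ 2 := fun h2 => h.not_normal (Subgroup.normal_of_index_eq_two h2)

/-- The core of `L` has a complement in `L`, of coprime order. -/
theorem exists_complement [Finite G] [Group.IsSolvable G] (h : IsUniqueNonnormalMaximal L x) :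
    ∃ T : Subgroup G, T ≤ L ∧ IsCyclic T ∧ T ⊓ L.normalCore = ⊥ ∧
      Nat.card T * Nat.card L.normalCore = Nat.card L ∧
      (Nat.card L.normalCore).Coprime (Nat.card T) ∧ Squarefree (Nat.card L.normalCore) := by
  have := h.isCyclic
  obtain ⟨y, hy⟩ := IsCyclic.exists_generator (α := L)
  have hdvd : Nat.card L.normalCore ∣ Nat.card L := Subgroup.card_dvd_of_le L.normalCore_le
  obtain ⟨t, ht⟩ := hdvd
  have hn0 : 0 < Nat.card L.normalCore := Nat.card_pos
  have ho : orderOf (y : G) = Nat.card L := by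
    rw [Subgroup.orderOf_coe, orderOf_eq_card_of_forall_mem_zpowers hy]
  have hT : Nat.card (Subgroup.zpowers ((y : G) ^ Nat.card L.normalCore)) = t := by
    rw [Nat.card_zpowers, orderOf_pow_of_dvd hn0.ne' (by rw [ho, ht]; exact dvd_mul_right _ _),
      ho, ht, Nat.mul_div_cancel_left _ hn0]
  -- A prime dividing both the order of the core and t would divide |L| twice.
  have hcop : (Nat.card L.normalCore).Coprime t := by
    refine Nat.coprime_of_dvd fun p hp h1 h2 => h.not_sq_dvd_card hp h1 ?_
    rw [ht, sq]
    exact mul_dvd_mul h1 h2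
  refine ⟨Subgroup.zpowers ((y : G) ^ Nat.card L.normalCore), ?_, inferInstance, ?_, ?_, ?_, ?_⟩
  · exact Subgroup.zpowers_le.mpr (pow_mem y.2 _)
  · exact disjoint_iff.mp
      (Subgroup.disjoint_of_coprime_natCard (by rw [hT]; exact hcop.symm))
  · rw [hT, ht, mul_comm]
  · rwa [hT]
  · refine Nat.squarefree_iff_prime_squarefree.mpr fun p hp hpp => ?_
    refine h.not_sq_dvd_card hp ((dvd_mul_right p p).trans hpp) ?_
    rw [ht, sq]
    exact hpp.mul_right t

/-- T acts faithfully on G', since the elements of L centralizing G' lie in the core. -/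
theorem card_dvd_card_mulAut [Finite G] (h : IsUniqueNonnormalMaximal L x) {T : Subgroup G}
    (hTL : T ≤ L) (hT : T ⊓ L.normalCore = ⊥) : Nat.card T ∣ Nat.card (MulAut (commutator G)) := by
  refine Subgroup.card_dvd_of_injective
    ((MulAut.conjNormal : G →* MulAut (commutator G)).comp T.subtype) ?_
  rw [injective_iff_map_eq_one]
  intro t ht
  have h1 : (t : G) ∈ T ⊓ L.normalCore := by
    refine ⟨t.2, h.mem_normalCore (hTL t.2) fun b hb => ?_⟩
    have h2 := congrArg Subtype.val (DFunLike.congr_fun ht ⟨b, hb⟩)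
    have h3 : (t : G) * b * (t : G)⁻¹ = b := by simpa [MulAut.conjNormal_apply] using h2
    exact mul_inv_eq_iff_eq_mul.mp h3
  rw [hT, Subgroup.mem_bot] at h1
  exact Subtype.ext h1

/-- The structure of the groups with cyclic abelianization, trivial Frattini subgroup and a unique
conjugacy class of non-normal maximal subgroups. -/
theorem exists_mulEquiv [Finite G] [Group.IsSolvable G] (h : IsUniqueNonnormalMaximal L x) :
    ∃ q k : ℕ, q.Prime ∧ 0 < k ∧ q ^ k = L.index ∧
    ∃ (t : ℕ) (φ : CyclicGroupZ t →* MulAut (ElementaryAbelian q k)) (ℓ : ℕ) (p : Fin ℓ → ℕ),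
      t ∣ Nat.card (MulAut (ElementaryAbelian q k)) ∧
      (∀ i, (p i).Prime) ∧ Function.Injective p ∧ (∀ i, (p i).Coprime t) ∧
      (Nat.card L).primeFactors.card = ℓ + numMaximalSubgroups (CyclicGroupZ t) ∧
      Nonempty (G ≃* (ElementaryAbelian q k ⋊[φ] CyclicGroupZ t) × CyclicGroupZ (∏ i, p i)) := by
  obtain ⟨q, hq, hpow⟩ := pow_prime_eq_one_of_minimal_normal h.commutator_ne_bot
    h.commutator_minimal h.commutator_comm
  obtain ⟨k, ⟨eE⟩⟩ := exists_mulEquiv_elementaryAbelian (B := commutator G) hq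
    (fun a b => Subtype.ext (h.commutator_comm a a.2 b b.2)) fun z => Subtype.ext (hpow z z.2)
  have hcardE : q ^ k = L.index := by
    rw [← card_elementaryAbelian hq, Nat.card_congr eE.toEquiv, h.card_commutator]
  obtain ⟨T, hTL, hTc, hTN, hcard, hcop, hsq⟩ := h.exists_complement
  obtain ⟨eT⟩ := exists_mulEquiv_cyclicGroupZ (C := T) rfl
  have hNc : IsCyclic L.normalCore := by
    have := h.isCyclic
    exact isCyclic_of_injective (Subgroup.inclusion L.normalCore_le)
      (Subgroup.inclusion_injective _)
  obtain ⟨eN⟩ := exists_mulEquiv_cyclicGroupZ (C := L.normalCore)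
    (prod_equivFin_primeFactors hsq).symm
  obtain ⟨e⟩ := exists_mulEquiv_semidirectProduct_prod h.commutator_inf hTL L.normalCore_le hTN
    (fun z hz g => (h.normalCore_central hz g).symm)
    (by rw [mul_assoc, hcard, h.card_commutator, mul_comm, L.card_mul_index])
  refine ⟨q, k, hq, Nat.pos_of_ne_zero ?_, hcardE, Nat.card T, _, _, _, ?_, ?_, ?_, ?_, ?_,
    ⟨e.trans (MulEquiv.prodCongr (SemidirectProduct.congr' eE.symm eT.symm) eN.symm)⟩⟩
  · rintro rfl
    rw [pow_zero, eq_comm, Subgroup.index_eq_one] at hcardE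
    exact h.isCoatom.1 hcardE
  · rw [Nat.card_congr (MulAut.congr eE).toEquiv]
    exact h.card_dvd_card_mulAut hTL hTN
  · exact fun i => Nat.prime_of_mem_primeFactors (Subtype.prop _)
  · exact Subtype.val_injective.comp (Equiv.injective _)
  · exact fun i => hcop.coprime_dvd_left (Nat.dvd_of_mem_primeFactors (Subtype.prop _))
  -- The prime divisors of |L| split into those of t and those of the core, and the latter are the p
  -- i.
  · rw [numMaximalSubgroups_cyclicGroupZ Nat.card_pos.ne', ← hcard,
      hcop.symm.primeFactors_mul, Finset.card_union_of_disjoint hcop.symm.disjoint_primeFactors,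
      add_comm]

end IsUniqueNonnormalMaximal

/-! ### Passage to the Frattini quotient and conclusion -/

theorem frattini_quotient_frattini (G : Type*) [Group G] : frattini (G ⧸ frattini G) = ⊥ := by
  rw [eq_bot_iff]
  intro z hz
  obtain ⟨g, rfl⟩ := QuotientGroup.mk_surjective z
  refine (QuotientGroup.eq_one_iff g).mpr
    (Subgroup.mem_iInf.mpr fun M => Subgroup.mem_iInf.mpr fun hM => ?_ :
      g ∈ ⨅ (M : Subgroup G) (_ : IsCoatom M), M)
  have hker : (QuotientGroup.mk' (frattini G)).ker ≤ M := by
    rw [QuotientGroup.ker_mk']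
    exact frattini_le_coatom hM
  have h1 := frattini_le_coatom
    (isCoatom_map_of_ker_le (QuotientGroup.mk'_surjective (frattini G)) hM hker) hz
  obtain ⟨m, hm, hmg⟩ := h1
  have h2 : m⁻¹ * g ∈ frattini G := QuotientGroup.eq.mp hmg
  have := mul_mem hm (frattini_le_coatom hM h2)
  rwa [mul_inv_cancel_left] at this

theorem numMaximalSubgroups_quotient_frattini (G : Type*) [Group G] :
    numMaximalSubgroups (G ⧸ frattini G) = numMaximalSubgroups G := by
  rw [← ncard_isCoatom_ker_le (QuotientGroup.mk'_surjective (frattini G)),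
    QuotientGroup.ker_mk', numMaximalSubgroups_eq_ncard]
  congr 1
  ext M
  exact and_iff_left_of_imp frattini_le_coatom

/-- The members of a cover may be enlarged to maximal subgroups; these contain Φ, so their images
remain proper. -/
theorem coveringNumber_quotient_frattini {G : Type*} [Group G] [Finite G]
    (h : ¬ IsCyclic (G ⧸ frattini G)) : coveringNumber (G ⧸ frattini G) = coveringNumber G := by
  have hsurj := QuotientGroup.mk'_surjective (frattini G)
  refine le_antisymm ?_ (coveringNumber_le_of_surjective h _ hsurj)
  have hG : ¬ IsCyclic G := fun _ => h (isCyclic_of_surjective _ hsurj)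
  obtain ⟨H, h1, h2⟩ := exists_cover hG
  choose M hM hle using fun i => (eq_top_or_exists_le_coatom (H i)).resolve_left (h1 i)
  refine (coveringNumber_le_card (fun i => (M i).map (QuotientGroup.mk' (frattini G)))
    (fun i => ?_) fun z => ?_).trans_eq (Nat.card_fin _)
  · refine (isCoatom_map_of_ker_le hsurj (hM i) ?_).1
    rw [QuotientGroup.ker_mk']
    exact frattini_le_coatom (hM i)
  · obtain ⟨g, rfl⟩ := hsurj z
    obtain ⟨i, hi⟩ := h2 g
    exact ⟨i, g, hle i hi, rfl⟩

theorem corollary3p4 (G : Type*) [Group G] [Finite G] (hsol : Group.IsSolvable G)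
    (hnil : ¬ Group.IsNilpotent G)
    (hm : (numMaximalSubgroups G : ℤ) < 2 * (coveringNumber G : ℤ) - 1) :
    coveringNumber G ≠ 3 ∧
    ∃ (q k : ℕ), q.Prime ∧ 0 < k ∧ (q : ℤ) ^ k = (coveringNumber G : ℤ) - 1 ∧
    ∃ (t : ℕ) (φ : CyclicGroupZ t →* MulAut (ElementaryAbelian q k)) (ℓ : ℕ) (p : Fin ℓ → ℕ),
      t ∣ Nat.card (MulAut (ElementaryAbelian q k)) ∧
      (∀ i, (p i).Prime) ∧ Function.Injective p ∧ (∀ i, (p i).Coprime t) ∧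
      (ℓ : ℤ) = (numMaximalSubgroups G : ℤ) - (numMaximalSubgroups (CyclicGroupZ t) : ℤ)
        - (coveringNumber G : ℤ) + 1 ∧
      Nonempty ((G ⧸ frattini G) ≃*
        (ElementaryAbelian q k ⋊[φ] CyclicGroupZ t) × CyclicGroupZ (∏ i, p i)) := by
  obtain ⟨L, hL, hLn⟩ : ∃ L : Subgroup G, IsCoatom L ∧ ¬ L.Normal := by
    by_contra! h
    exact hnil ((Group.isNilpotent_of_finite_tfae.out 0 2 rfl rfl).mpr h)
  have hsurj := QuotientGroup.mk'_surjective (frattini G)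
  have hker : (QuotientGroup.mk' (frattini G)).ker ≤ L := by
    rw [QuotientGroup.ker_mk']
    exact frattini_le_coatom hL
  have hL' := isCoatom_map_of_ker_le hsurj hL hker
  have hLn' : ¬ (L.map (QuotientGroup.mk' (frattini G))).Normal :=
    fun h => hLn (normal_of_map_normal hker h)
  have hcyc : ¬ IsCyclic (G ⧸ frattini G) := fun h => hLn' inferInstance
  rw [← numMaximalSubgroups_quotient_frattini, ← coveringNumber_quotient_frattini hcyc] at hm ⊢
  obtain ⟨⟨x, hx⟩, huniq⟩ := cyclic_and_unique_of_numMaximalSubgroups_lt hm hL' hLn'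
  have hU : IsUniqueNonnormalMaximal (L.map (QuotientGroup.mk' (frattini G))) x :=
    ⟨hL', hLn', huniq, hx, frattini_quotient_frattini G⟩
  have hσ := hU.coveringNumber_eq
  have hmax := hU.numMaximalSubgroups_eq
  obtain ⟨q, k, hq, hk, hqk, t, φ, ℓ, p, ht, hp, hinj, hcop, hℓ, he⟩ := hU.exists_mulEquiv
  -- σ = 3 would mean index 2, making L normal.
  refine ⟨fun h3 => hU.index_ne_two (by omega), q, k, hq, hk, ?_, t, φ, ℓ, p, ht, hp, hinj, hcop,
    by omega, he⟩
  rw [hσ, ← hqk]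
  push_cast
  ring
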